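/- Let $p$ be a prime and $k\ge 0$ an integer, and let $\Delta\subset\mathbb R^d$ be a lattice simplex of dimension $d$ (the convex hull of $d+1$ affinely independent points of $\mathbb Z^d$) whose $\delta$-polynomial $$\delta(\Delta,t)=(1-t)^{d+1}\Bigl(1+\sum_{n\ge1}|n\Delta\cap\mathbb Z^d|\,t^n\Bigr)$$ equals $1+t^{k+1}+t^{2(k+1)}+\cdots+t^{(p^2-1)(k+1)}$. Two sets $P,Q\subset\mathbb R^d$ are unimodularly equivalent if $Q=\{vU+w : v\in P\}$ for some $U\in\mathbb Z^{d\times d}$ with $\det U=\pm1$ and some $w\in\mathbb Z^d$. Suppose that $\Delta$ is not a lattice pyramid over a lower-dimensional lattice simplex, i.e. $\Delta$ is not unimodularly equivalent to $\mathrm{Pyr}(Q)=\mathrm{conv}\bigl(Q\times\{0\}\cup\{(0,\ldots,0,1)\}\bigr)$ for any $(d-1)$-dimensional lattice simplex $Q\subset\mathbb R^{d-1}$. For an integer sequence $A=(a_1,\ldots,a_d)$ let $\Delta(A)\subset\mathbb R^d$ be the convex hull of the origin, the unit vectors $e_1,\ldots,e_{d-1}$ and $(a_d-a_1,\ldots,a_d-a_{d-1},a_d)$.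 For integer sequences $B=(b_1,\ldots,b_s)$ and $C=(c_1,\ldots,c_d)$ with $1\le s<d$ let $\Delta(B,C)\subset\mathbb R^d$ be the convex hull of the origin, the unit vectors $e_i$ with $1\le i\le d-1$, $i\ne s$, and the two vectors $(b_s-b_1,\ldots,b_s-b_{s-1},b_s,0,\ldots,0)$ and $(c_d-c_1,\ldots,c_d-c_{d-1},c_d)$. Then $\Delta$ is unimodularly equivalent to one of $\Delta(A_1)$, $\Delta(A_2)$ and $\Delta(B,C)$ (in particular, $d$ is the length of $A_1$, $A_2$ or $C$, respectively), where 1. $A_1=(\underbrace{1,\ldots,1}_{p^2(k+1)-2},\,p^2)$; 2. $A_2=(\underbrace{1,\ldots,1}_{p(k+1)-1},\,\underbrace{p,\ldots,p}_{(p^2-1)(k+1)-1},\,p^2)$; 3. $B=(\underbrace{1,\ldots,1}_{p(k+1)-1},\,p)$ and $C=(\underbrace{p,\ldots,p}_{p(k+1)},\,\underbrace{1,\ldots,1}_{p^2(k+1)-2},\,p)$. -/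

import Mathlib

open scoped Matrix Pointwise

noncomputable section

namespace LatticeSimplices

/-- The point of `ℝ^d` with the given integer coordinates. -/
def toReal {d : ℕ} (v : Fin d → ℤ) : Fin d → ℝ := fun i => (v i : ℝ)

/-- `P ⊆ ℝ^d` is a lattice simplex of (full) dimension `d`: the convex hull of `d + 1` affinely
independent points with integer coordinates. -/
def IsLatticeSimplex {d : ℕ} (P : Set (Fin d → ℝ)) : Prop :=
  ∃ v : Fin (d + 1) → Fin d → ℤ,
    AffineIndependent ℝ (fun i => toReal (v i)) ∧
    P = convexHull ℝ (Set.range fun i => toReal (v i))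

/-- The number `|nP ∩ ℤ^d|` of lattice points in the `n`-th dilate of `P`. -/
def latticeCount {d : ℕ} (P : Set (Fin d → ℝ)) (n : ℕ) : ℕ :=
  Set.ncard (((n : ℝ) • P) ∩ Set.range (toReal (d := d)))

/-- The `δ`-polynomial of a `d`-dimensional lattice polytope `P ⊆ ℝ^d`, as the formal power series
`δ(P, t) = (1 - t)^(d + 1) * (1 + ∑_{n ≥ 1} |nP ∩ ℤ^d| t^n)`. -/
def deltaSeries {d : ℕ} (P : Set (Fin d → ℝ)) : PowerSeries ℤ :=
  (1 - PowerSeries.X) ^ (d + 1) *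
    PowerSeries.mk (fun n => if n = 0 then 1 else (latticeCount P n : ℤ))

/-- `P` and `Q` are unimodularly equivalent: `Q` is the image of `P` under `v ↦ vU + w` with
`U` an integer matrix of determinant `±1` and `w` an integer vector. -/
def UnimodularlyEquivalent {d : ℕ} (P Q : Set (Fin d → ℝ)) : Prop :=
  ∃ (U : Matrix (Fin d) (Fin d) ℤ) (w : Fin d → ℤ),
    (U.det = 1 ∨ U.det = -1) ∧
    Q = (fun v : Fin d → ℝ => v ᵥ* U.map (fun z : ℤ => (z : ℝ)) + toReal w) '' P

/-- `Pyr(P) = conv(P × {0}, (0, …, 0, 1)) ⊆ ℝ^(d + 1)`. -/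
def pyramid {d : ℕ} (P : Set (Fin d → ℝ)) : Set (Fin (d + 1) → ℝ) :=
  convexHull ℝ
    (insert (Fin.snoc (α := fun _ => ℝ) (0 : Fin d → ℝ) 1)
      ((fun x : Fin d → ℝ => Fin.snoc (α := fun _ => ℝ) x 0) '' P))

/-- `P ⊆ ℝ^d` is, up to unimodular equivalence, the lattice pyramid over a lattice simplex of
dimension `d - 1`. (A subset of `ℝ^0` is never a pyramid.) -/
def IsLatticePyramid : {d : ℕ} → Set (Fin d → ℝ) → Prop
  | 0, _ => False
  | d + 1, P => ∃ Q : Set (Fin d → ℝ), IsLatticeSimplex Q ∧ UnimodularlyEquivalent P (pyramid Q)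

/-- The convex hull of the origin and the rows of an integer matrix. -/
def rowSimplex {d : ℕ} (M : Matrix (Fin d) (Fin d) ℤ) : Set (Fin d → ℝ) :=
  convexHull ℝ (insert 0 (Set.range fun i => toReal (M i)))

/-- The matrix with rows `e_1, …, e_{d-1}` and `(a_d - a_1, …, a_d - a_{d-1}, a_d)`.
Indices of `Fin d` start from `0`, so the last row is the one with `i + 1 = d`. -/
def matrixA {d : ℕ} (A : Fin d → ℤ) : Matrix (Fin d) (Fin d) ℤ :=
  Matrix.of fun i j =>
    if (i : ℕ) + 1 = d then (if j = i then A i else A i - A j)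
    else if j = i then 1 else 0

/-- The simplex `Δ(A)`. -/
def simplexA {d : ℕ} (A : Fin d → ℤ) : Set (Fin d → ℝ) :=
  rowSimplex (matrixA A)

/-- The matrix whose `s`-th row is `(b_s - b_1, …, b_s - b_{s-1}, b_s, 0, …, 0)`, whose `d`-th row
is `(c_d - c_1, …, c_d - c_{d-1}, c_d)`, and whose other rows are unit vectors
(meant for `1 ≤ s < d`). -/
def matrixBC {s d : ℕ} (B : Fin s → ℤ) (C : Fin d → ℤ) : Matrix (Fin d) (Fin d) ℤ :=
  Matrix.of fun i j =>
    if (i : ℕ) + 1 = d then (if j = i then C i else C i - C j)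
    else if hi : (i : ℕ) + 1 = s then
      (if j = i then B ⟨i, by omega⟩
       else if hj : (j : ℕ) < s then B ⟨i, by omega⟩ - B ⟨j, hj⟩
       else 0)
    else if j = i then 1 else 0

/-- The simplex `Δ(B, C)`. -/
def simplexBC {s d : ℕ} (B : Fin s → ℤ) (C : Fin d → ℤ) : Set (Fin d → ℝ) :=
  rowSimplex (matrixBC B C)

/-- The sequence `(1, …, 1, p²)` with `p²(k+1) - 2` ones. -/
def listA₁ (p k : ℕ) : List ℤ :=
  List.replicate (p ^ 2 * (k + 1) - 2) 1 ++ [(p : ℤ) ^ 2]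

/-- The sequence `(1, …, 1, p, …, p, p²)` with `p(k+1) - 1` ones and
`(p² - 1)(k+1) - 1` entries `p`. -/
def listA₂ (p k : ℕ) : List ℤ :=
  List.replicate (p * (k + 1) - 1) 1 ++
    List.replicate ((p ^ 2 - 1) * (k + 1) - 1) (p : ℤ) ++ [(p : ℤ) ^ 2]

/-- The sequence `(1, …, 1, p)` with `p(k+1) - 1` ones. -/
def listB (p k : ℕ) : List ℤ :=
  List.replicate (p * (k + 1) - 1) 1 ++ [(p : ℤ)]

/-- The sequence `(p, …, p, 1, …, 1, p)` with `p(k+1)` initial entries `p` and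
`p²(k+1) - 2` ones. -/
def listC (p k : ℕ) : List ℤ :=
  List.replicate (p * (k + 1)) (p : ℤ) ++
    List.replicate (p ^ 2 * (k + 1) - 2) 1 ++ [(p : ℤ)]

end LatticeSimplices

end

open scoped Matrix Pointwise

noncomputable section

namespace LatticeSimplices

/-! Let L (`relLattice`) be the lattice of all real vectors c, indexed by the vertices v_i of Δ, for
which ∑ c_i and ∑ c_i v_i are integral. It contains ℤ^(d+1), and the classes of L/ℤ^(d+1) are
represented by the points of L in [0,1)^(d+1). Such a point has a height ∑ c_i, and δ(Δ,t) is the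
sum of t^height over these points (`deltaSeries_convexHull`). With m = k+1, the hypothesis says that
height/m is a bijection from the finite group L/ℤ^(d+1) onto {0,…,p²-1}. It is subadditive, because
fractional parts are.

This is very rigid. If x has height m, then a·x has height at most am, and injectivity forces
equality as long as a is below the order of x. So either x generates the group, or x has order p
and, for y of height pm, the elements iy+jx with digits i, j < p have height (ip+j)m
(`exists_generators_of_subadditive_bijection`). Equality in subadditivity means that no coordinate
wraps around: (p²-1)x_i < 1 in one case and (p-1)(x_i+y_i) < 1 in the other. Integrality of p²x_i or
p·x_i then leaves very few values.

If Δ is not a pyramid, no coordinate is integral on all of L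
(`isLatticePyramid_of_integral_coordinate`). This leaves three lattices, with the numbers of
coordinates of each kind fixed by the heights of x and y (`lattice_classification`). They are the
relation lattices of Δ(A₁), Δ(A₂) and Δ(B,C) up to a permutation of vertices
(`mem_relLattice_matrixA`, `mem_relLattice_matrixBC`), and the relation lattice determines a simplex
up to unimodular equivalence (`unimodularlyEquivalent_of_relLattice_eq`). -/

/-! ### Subadditive bijections on groups of order p². -/

/-- If g a < a, then by induction g already takes the value g a at the point g a, against
injectivity. This turns the upper bounds coming from subadditivity into equalities. -/
theorem eq_self_of_injOn_of_le {n : ℕ} {g : ℕ → ℕ} (hinj : Set.InjOn g (Set.Iio n))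
    (hle : ∀ a < n, g a ≤ a) : ∀ a < n, g a = a := by
  intro a
  induction a using Nat.strong_induction_on with
  | _ a ih =>
    intro ha
    rcases (hle a ha).lt_or_eq with h | h
    · exact hinj (Set.mem_Iio.2 (h.trans ha)) (Set.mem_Iio.2 ha) (ih _ h (h.trans ha))
    · exact h

theorem subadditive_nsmul_le {Q : Type*} [AddCommGroup Q] {h : Q → ℕ} (h0 : h 0 = 0)
    (hadd : ∀ a b, h (a + b) ≤ h a + h b) (x : Q) (a : ℕ) : h (a • x) ≤ a * h x := by
  induction a with
  | zero => simp [h0]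
  | succ a ih =>
    rw [succ_nsmul, add_mul, one_mul]
    exact (hadd _ _).trans (Nat.add_le_add_right ih _)

/-- A finite abelian group of order `p²` with a subadditive bijection onto `{0, …, p² - 1}` has
generators on which this bijection is given by base `p` expansion. -/
theorem exists_generators_of_subadditive_bijection {Q : Type*} [AddCommGroup Q] {p : ℕ}
    (hp : p.Prime) {h : Q → ℕ} (h0 : h 0 = 0) (hadd : ∀ a b, h (a + b) ≤ h a + h b)
    (hinj : Function.Injective h) (hran : ∀ a, (∃ q, h q = a) ↔ a < p ^ 2) :
    (∃ x : Q, (∀ q, ∃ a : ℕ, q = a • x) ∧ p ^ 2 • x = 0 ∧ ∀ a < p ^ 2, h (a • x) = a) ∨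
    (∃ x y : Q, p • x = 0 ∧ (∃ j < p, p • y = j • x) ∧ (∀ q, ∃ i j : ℕ, q = i • y + j • x) ∧
      ∀ i < p, ∀ j < p, h (i • y + j • x) = i * p + j) := by
  have hlt : ∀ q, h q < p ^ 2 := fun q => (hran _).1 ⟨q, rfl⟩
  have hcard : Nat.card Q = p ^ 2 := by
    have e : Q ≃ Fin (p ^ 2) := Equiv.ofBijective (fun q => ⟨h q, hlt q⟩)
      ⟨fun a b hab => hinj (by simpa using hab), fun b => by
        obtain ⟨q, hq⟩ := (hran b).2 b.2
        exact ⟨q, Fin.ext hq⟩⟩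
    rw [Nat.card_congr e, Nat.card_fin]
  have hsq : ∀ q : Q, p ^ 2 • q = 0 := fun q => by rw [← hcard]; exact card_nsmul_eq_zero'
  have hp2 : p < p ^ 2 := by nlinarith [hp.two_le]
  obtain ⟨x, hx⟩ := (hran 1).2 (by nlinarith [hp.two_le])
  have hordx : ∀ a < addOrderOf x, h (a • x) = a := by
    refine eq_self_of_injOn_of_le (g := fun a => h (a • x)) ?_ ?_
    · intro a ha b hb hab
      exact nsmul_injOn_Iio_addOrderOf ha hb (hinj hab)
    · intro a _
      simpa [hx] using subadditive_nsmul_le h0 hadd x a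
  obtain ⟨i, hi, hord⟩ := (Nat.dvd_prime_pow hp).1 (addOrderOf_dvd_of_nsmul_eq_zero (hsq x))
  interval_cases i
  · rw [pow_zero, AddMonoid.addOrderOf_eq_one_iff] at hord
    rw [hord, h0] at hx
    omega
  · right
    rw [pow_one] at hord
    rw [hord] at hordx
    have hpx : p • x = 0 := by rw [← hord]; exact addOrderOf_nsmul_eq_zero x
    obtain ⟨y, hy⟩ := (hran p).2 hp2
    have hmem : ∀ q ∈ AddSubgroup.zmultiples x, ∃ j < p, q = j • x := by
      rintro _ ⟨z, rfl⟩
      have hpos : (0 : ℤ) < p := by exact_mod_cast hp.pos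
      refine ⟨(z % p).toNat, ?_, ?_⟩
      · have := Int.emod_lt_of_pos z hpos
        have := Int.emod_nonneg z hpos.ne'
        omega
      · rw [← natCast_zsmul, Int.toNat_of_nonneg (Int.emod_nonneg z hpos.ne')]
        conv_lhs => rw [← Int.emod_add_mul_ediv z p]
        simp only [add_zsmul, mul_comm (p : ℤ), mul_zsmul, natCast_zsmul, hpx, zsmul_zero, add_zero]
    -- Multiples of x have values below p, while `h y = p`.
    have hynot : y ∉ AddSubgroup.zmultiples x := by
      intro hmy
      obtain ⟨j, hj, rfl⟩ := hmem y hmy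
      rw [hordx j hj] at hy
      omega
    -- Since p² kills the group, an e prime to p is invertible modulo p², and e • y ∈ ⟨x⟩ would put
    -- y itself in ⟨x⟩.
    have hdvd : ∀ e : ℤ, e • y ∈ AddSubgroup.zmultiples x → (p : ℤ) ∣ e := by
      intro e he
      by_contra hnd
      have hcop : IsCoprime e ((p : ℤ) ^ 2) :=
        ((Nat.prime_iff_prime_int.1 hp).coprime_iff_not_dvd.2 hnd).symm.pow_right
      obtain ⟨u, v, huv⟩ := hcop
      apply hynot
      have : y = u • (e • y) + v • (((p ^ 2 : ℕ) : ℤ) • y) := by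
        rw [← mul_zsmul, ← mul_zsmul, ← add_zsmul, Nat.cast_pow, huv, one_zsmul]
      rw [this, natCast_zsmul, hsq, zsmul_zero, add_zero]
      exact AddSubgroup.zsmul_mem _ he _
    have hnx : ∀ j : ℕ, j • x ∈ AddSubgroup.zmultiples x := fun j => ⟨j, by simp⟩
    -- Same squeeze as for x alone, now along base p digits: subadditivity bounds the value by
    -- p(a/p) + a%p = a.
    have hh : ∀ a < p ^ 2, h ((a / p) • y + (a % p) • x) = a := by
      refine eq_self_of_injOn_of_le (g := fun a => h ((a / p) • y + (a % p) • x)) ?_ ?_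
      · intro a ha b hb hab
        have hab := hinj hab
        have hdiv : ∀ c : ℕ, c ∈ Set.Iio (p ^ 2) → c / p < p := fun c hc =>
          Nat.div_lt_of_lt_mul (by rw [← sq]; exact hc)
        have h1 : (((a / p : ℕ) : ℤ) - ((b / p : ℕ) : ℤ)) • y ∈ AddSubgroup.zmultiples x := by
          have : (((a / p : ℕ) : ℤ) - ((b / p : ℕ) : ℤ)) • y = (b % p) • x - (a % p) • x := by
            rw [sub_zsmul, natCast_zsmul, natCast_zsmul, ← sub_eq_add_neg,
              sub_eq_sub_iff_add_eq_add, hab, add_comm]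
          rw [this]
          exact AddSubgroup.sub_mem _ (hnx _) (hnx _)
        have h2 := hdvd _ h1
        have h3 : a / p = b / p := by
          have ha' : ((a / p : ℕ) : ℤ) < p := by exact_mod_cast hdiv a ha
          have hb' : ((b / p : ℕ) : ℤ) < p := by exact_mod_cast hdiv b hb
          have ha0 := Int.natCast_nonneg (a / p)
          have hb0 := Int.natCast_nonneg (b / p)
          have h3 := Int.eq_zero_of_abs_lt_dvd h2 (by rw [abs_lt]; constructor <;> linarith)
          exact_mod_cast sub_eq_zero.1 h3
        rw [h3] at hab
        have h4 := congrArg h (add_left_cancel hab)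
        rw [hordx _ (Nat.mod_lt _ hp.pos), hordx _ (Nat.mod_lt _ hp.pos)] at h4
        rw [← Nat.div_add_mod a p, ← Nat.div_add_mod b p, h3, h4]
      · intro a _
        have h1 := subadditive_nsmul_le h0 hadd x (a % p)
        have h2 := subadditive_nsmul_le h0 hadd y (a / p)
        rw [hx, mul_one] at h1
        rw [hy, mul_comm] at h2
        calc h ((a / p) • y + (a % p) • x) ≤ h ((a / p) • y) + h ((a % p) • x) := hadd _ _
          _ ≤ p * (a / p) + a % p := Nat.add_le_add h2 h1
          _ = a := Nat.div_add_mod a p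
    have hsurj : ∀ q, ∃ i < p, ∃ j < p, q = i • y + j • x := fun q =>
      ⟨h q / p, Nat.div_lt_of_lt_mul (by rw [← sq]; exact hlt q), h q % p, Nat.mod_lt _ hp.pos,
        hinj (hh _ (hlt q)).symm⟩
    refine ⟨x, y, hpx, ?_, ?_, ?_⟩
    · apply hmem
      obtain ⟨i, hi, j, hj, hij⟩ := hsurj (p • y)
      -- Writing p • y = i • y + j • x, the element (p - i) • y lies in ⟨x⟩, so p divides i < p and
      -- i = 0.
      have h1 : ((p : ℤ) - i) • y ∈ AddSubgroup.zmultiples x := by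
        rw [sub_zsmul, natCast_zsmul, natCast_zsmul, hij, ← sub_eq_add_neg, add_sub_cancel_left]
        exact hnx j
      have h2 := (dvd_sub_right (dvd_refl (p : ℤ))).1 (hdvd _ h1)
      have h3 : i = 0 := Nat.eq_zero_of_dvd_of_lt (Int.natCast_dvd_natCast.1 h2) hi
      rw [hij, h3, zero_nsmul, zero_add]
      exact hnx j
    · intro q
      obtain ⟨i, _, j, _, hq⟩ := hsurj q
      exact ⟨i, j, hq⟩
    · intro i hi j hj
      have h1 := hh (i * p + j) (by nlinarith)
      have h2 : (i * p + j) / p = i := by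
        rw [add_comm, Nat.add_mul_div_right _ _ hp.pos, Nat.div_eq_of_lt hj, zero_add]
      have h3 : (i * p + j) % p = j := by
        rw [add_comm, Nat.add_mul_mod_self_right, Nat.mod_eq_of_lt hj]
      rwa [h2, h3] at h1
  · left
    rw [hord] at hordx
    exact ⟨x, fun q => ⟨h q, hinj (hordx _ (hlt q)).symm⟩, hsq x, hordx⟩

/-! ### Relation lattices and the δ-polynomial of a simplex. -/

/-- The real coefficient vectors whose sum, and whose combination of the points `v i`, are
integral. -/
def relLattice {ι : Type*} [Fintype ι] {d : ℕ} (v : ι → Fin d → ℤ) : AddSubgroup (ι → ℝ) where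
  carrier := {c | (∃ z : ℤ, ∑ i, c i = z) ∧ ∃ w : Fin d → ℤ, ∑ i, c i • toReal (v i) = toReal w}
  zero_mem' := ⟨⟨0, by simp⟩, 0, by ext; simp [toReal]⟩
  add_mem' := by
    rintro a b ⟨⟨z, hz⟩, w, hw⟩ ⟨⟨z', hz'⟩, w', hw'⟩
    refine ⟨⟨z + z', by simp [Finset.sum_add_distrib, hz, hz']⟩, w + w', ?_⟩
    simp only [Pi.add_apply, add_smul, Finset.sum_add_distrib, hw, hw']
    ext; simp [toReal]
  neg_mem' := by
    rintro a ⟨⟨z, hz⟩, w, hw⟩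
    refine ⟨⟨-z, by simp [hz]⟩, -w, ?_⟩
    simp only [Pi.neg_apply, neg_smul, Finset.sum_neg_distrib, hw]
    ext; simp [toReal]

theorem mem_relLattice {ι : Type*} [Fintype ι] {d : ℕ} {v : ι → Fin d → ℤ} {c : ι → ℝ} :
    c ∈ relLattice v ↔
      (∃ z : ℤ, ∑ i, c i = z) ∧ ∃ w : Fin d → ℤ, ∑ i, c i • toReal (v i) = toReal w :=
  Iff.rfl

theorem intCast_mem_relLattice {ι : Type*} [Fintype ι] {d : ℕ} (v : ι → Fin d → ℤ) (f : ι → ℤ) :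
    (fun i => (f i : ℝ)) ∈ relLattice v := by
  refine ⟨⟨∑ i, f i, by push_cast; rfl⟩, ∑ i, f i • v i, ?_⟩
  ext j
  simp [toReal]

/-- The elements of a subgroup of `ℝ^ι` lying in the half-open unit cube. -/
def unitBox {ι : Type*} (L : AddSubgroup (ι → ℝ)) : Set (ι → ℝ) :=
  {c | c ∈ L ∧ ∀ i, 0 ≤ c i ∧ c i < 1}

theorem convexHull_range_eq_image {ι E : Type*} [Fintype ι] [AddCommGroup E] [Module ℝ E]
    (f : ι → E) :
    convexHull ℝ (Set.range f) = {x | ∃ c : ι → ℝ, (∀ i, 0 ≤ c i) ∧ ∑ i, c i = 1 ∧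
      ∑ i, c i • f i = x} := by
  classical
  have h := (Fintype.linearCombination ℝ f).image_convexHull
    (Set.range fun i j : ι => if i = j then (1 : ℝ) else 0)
  rw [convexHull_basis_eq_stdSimplex, ← Set.range_comp] at h
  have h1 : (Fintype.linearCombination ℝ f ∘ fun i j : ι => if i = j then (1 : ℝ) else 0) = f := by
    ext i
    simp [Fintype.linearCombination_apply]
  rw [h1] at h
  rw [← h]
  ext x
  simp [stdSimplex, Fintype.linearCombination_apply, and_assoc]

section

variable {d : ℕ} {v : Fin (d + 1) → Fin d → ℤ}

/-- The linear map sending `c` to the pair `(∑ c i, ∑ c i • v i)`. -/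
def homogenization (v : Fin (d + 1) → Fin d → ℤ) :
    (Fin (d + 1) → ℝ) →ₗ[ℝ] ℝ × (Fin d → ℝ) :=
  (Fintype.linearCombination ℝ fun _ => (1 : ℝ)).prod
    (Fintype.linearCombination ℝ fun i => toReal (v i))

theorem homogenization_apply (c : Fin (d + 1) → ℝ) :
    homogenization v c = (∑ i, c i, ∑ i, c i • toReal (v i)) := by
  simp [homogenization, Fintype.linearCombination_apply]

theorem homogenization_injective (hv : AffineIndependent ℝ fun i => toReal (v i)) :
    Function.Injective (homogenization v) := by
  rw [← LinearMap.ker_eq_bot, LinearMap.ker_eq_bot']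
  intro c hc
  rw [homogenization_apply, Prod.mk_eq_zero] at hc
  ext i
  exact affineIndependent_iff.1 hv Finset.univ c hc.1 hc.2 i (Finset.mem_univ i)

theorem homogenization_bijective (hv : AffineIndependent ℝ fun i => toReal (v i)) :
    Function.Bijective (homogenization v) := by
  have h := homogenization_injective hv
  refine ⟨h, ?_⟩
  rwa [← LinearMap.injective_iff_surjective_of_finrank_eq_finrank]
  simp [add_comm]

theorem exists_coefficients (hv : AffineIndependent ℝ fun i => toReal (v i)) (a : ℝ)
    (x : Fin d → ℝ) : ∃ c : Fin (d + 1) → ℝ, ∑ i, c i = a ∧ ∑ i, c i • toReal (v i) = x := by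
  obtain ⟨c, hc⟩ := (homogenization_bijective hv).2 (a, x)
  rw [homogenization_apply, Prod.mk.injEq] at hc
  exact ⟨c, hc⟩

theorem coefficients_ext (hv : AffineIndependent ℝ fun i => toReal (v i))
    {c c' : Fin (d + 1) → ℝ} (h1 : ∑ i, c i = ∑ i, c' i)
    (h2 : ∑ i, c i • toReal (v i) = ∑ i, c' i • toReal (v i)) : c = c' := by
  apply homogenization_injective hv
  rw [homogenization_apply, homogenization_apply, h1, h2]

/-- Coefficients in [0,1) bound both the height and each coordinate of ∑ c_i v_i. These are
integers, and they determine c. -/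
theorem unitBox_finite (hv : AffineIndependent ℝ fun i => toReal (v i)) :
    (unitBox (relLattice v)).Finite := by
  have hfin : (Set.Icc (0 : ℤ) (d + 1) ×ˢ
      Set.Icc (fun j => -∑ i, |v i j|) (fun j => ∑ i, |v i j|)).Finite :=
    (Set.finite_Icc _ _).prod (Set.finite_Icc _ _)
  have hfin' := (hfin.image fun q : ℤ × (Fin d → ℤ) => ((q.1 : ℝ), toReal q.2)).preimage
    (homogenization_injective hv).injOn
  refine hfin'.subset ?_
  rintro c ⟨⟨⟨z, hz⟩, w, hw⟩, hc⟩
  refine ⟨(z, w), ⟨⟨?_, ?_⟩, ?_, ?_⟩, ?_⟩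
  · have : (0 : ℝ) ≤ z := hz ▸ Finset.sum_nonneg fun i _ => (hc i).1
    exact_mod_cast this
  · have : (z : ℝ) ≤ d + 1 := by
      rw [← hz]
      calc ∑ i, c i ≤ ∑ _i : Fin (d + 1), (1 : ℝ) := Finset.sum_le_sum fun i _ => (hc i).2.le
        _ = d + 1 := by simp
    exact_mod_cast this
  all_goals try intro j
  all_goals
    try
      have h1 : |(w j : ℝ)| ≤ ∑ i, |(v i j : ℝ)| := by
        have h2 : (w j : ℝ) = ∑ i, c i * v i j := by
          have := congrFun hw j
          simpa [toReal] using this.symm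
        rw [h2]
        refine (Finset.abs_sum_le_sum_abs _ _).trans (Finset.sum_le_sum fun i _ => ?_)
        rw [abs_mul, abs_of_nonneg (hc i).1]
        exact mul_le_of_le_one_left (abs_nonneg _) (hc i).2.le
      rw [abs_le] at h1
  · have := h1.1
    dsimp only
    exact_mod_cast this
  · have := h1.2
    dsimp only
    exact_mod_cast this
  · rw [homogenization_apply, hz, hw]

theorem mem_smul_convexHull_range_iff {ι E : Type*} [Fintype ι] [Nonempty ι] [AddCommGroup E]
    [Module ℝ E] (f : ι → E) (n : ℕ) (x : E) :
    x ∈ (n : ℝ) • convexHull ℝ (Set.range f) ↔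
      ∃ c : ι → ℝ, (∀ i, 0 ≤ c i) ∧ ∑ i, c i = n ∧ ∑ i, c i • f i = x := by
  rw [convexHull_range_eq_image, Set.mem_smul_set]
  constructor
  · rintro ⟨_, ⟨c, hc, h1, rfl⟩, rfl⟩
    refine ⟨fun i => n * c i, fun i => mul_nonneg n.cast_nonneg (hc i), ?_, ?_⟩
    · rw [← Finset.mul_sum, h1, mul_one]
    · simp [Finset.smul_sum, mul_smul]
  · rintro ⟨c, hc, h1, rfl⟩
    -- For n = 0 the coefficients cannot be rescaled; they all vanish, and any vertex witnesses that
    -- 0 lies in the zeroth dilate.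
    rcases Nat.eq_zero_or_pos n with rfl | hn
    · have h0 : ∀ i, c i = 0 := by
        rw [Nat.cast_zero, Finset.sum_eq_zero_iff_of_nonneg fun i _ => hc i] at h1
        exact fun i => h1 i (Finset.mem_univ i)
      classical
      obtain ⟨i⟩ := ‹Nonempty ι›
      refine ⟨f i, ⟨Pi.single i 1, fun j => ?_, ?_, ?_⟩, ?_⟩
      · by_cases h : j = i
        · subst h; simp
        · simp [h]
      · simp
      · simp [Pi.single_apply]
      · simp [h0]
    · have hn' : (n : ℝ) ≠ 0 := by positivity
      refine ⟨(n : ℝ)⁻¹ • ∑ i, c i • f i, ⟨fun i => (n : ℝ)⁻¹ * c i, fun i => ?_, ?_, ?_⟩, ?_⟩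
      · have := hc i
        positivity
      · rw [← Finset.mul_sum, h1, inv_mul_cancel₀ hn']
      · simp [Finset.smul_sum, mul_smul]
      · rw [smul_smul, mul_inv_cancel₀ hn', one_smul]

/-- The coefficient vectors of the lattice points in the `n`-th dilate. -/
def dilateCoefficients (v : Fin (d + 1) → Fin d → ℤ) (n : ℕ) : Set (Fin (d + 1) → ℝ) :=
  {c | c ∈ relLattice v ∧ (∀ i, 0 ≤ c i) ∧ ∑ i, c i = n}

theorem latticeCount_eq_ncard (hv : AffineIndependent ℝ fun i => toReal (v i)) (n : ℕ) :
    latticeCount (convexHull ℝ (Set.range fun i => toReal (v i))) n =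
      (dilateCoefficients v n).ncard := by
  have h : ((n : ℝ) • convexHull ℝ (Set.range fun i => toReal (v i))) ∩
      Set.range (toReal (d := d)) =
      (fun c : Fin (d + 1) → ℝ => ∑ i, c i • toReal (v i)) '' dilateCoefficients v n := by
    ext x
    rw [Set.mem_inter_iff, mem_smul_convexHull_range_iff]
    constructor
    · rintro ⟨⟨c, hc, h1, rfl⟩, w, hw⟩
      exact ⟨c, ⟨⟨⟨n, by simp [h1]⟩, w, hw.symm⟩, hc, h1⟩, rfl⟩
    · rintro ⟨c, ⟨⟨_, w, hw⟩, hc, h1⟩, rfl⟩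
      exact ⟨⟨c, hc, h1, rfl⟩, w, hw.symm⟩
  rw [latticeCount, h, Set.InjOn.ncard_image]
  rintro c ⟨_, _, hc⟩ c' ⟨_, _, hc'⟩ hcc
  exact coefficients_ext hv (hc.trans hc'.symm) hcc

theorem cast_floor_sum_of_mem_unitBox {c : Fin (d + 1) → ℝ} (hc : c ∈ unitBox (relLattice v)) :
    ((⌊∑ i, c i⌋₊ : ℕ) : ℝ) = ∑ i, c i := by
  obtain ⟨⟨⟨z, hz⟩, _⟩, hc⟩ := hc
  have h0 : 0 ≤ ∑ i, c i := Finset.sum_nonneg fun i _ => (hc i).1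
  rw [hz] at h0 ⊢
  lift z to ℕ using by exact_mod_cast h0
  simp

/-- Each coefficient vector splits uniquely into fractional parts, a box point x of some height h ≤
n, and floors, a vector of d+1 natural numbers with sum n - h. Stars and bars counts the latter. -/
theorem ncard_dilateCoefficients (hv : AffineIndependent ℝ fun i => toReal (v i)) (n : ℕ) :
    (dilateCoefficients v n).ncard = ∑ x ∈ (unitBox_finite hv).toFinset,
      if ⌊∑ i, x i⌋₊ ≤ n then (d + (n - ⌊∑ i, x i⌋₊)).choose d else 0 := by
  classical
  set T : Finset (Σ _ : Fin (d + 1) → ℝ, Fin (d + 1) →₀ ℕ) :=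
    ((unitBox_finite hv).toFinset.filter fun x => ⌊∑ i, x i⌋₊ ≤ n).sigma
      fun x => Finset.finsuppAntidiag Finset.univ (n - ⌊∑ i, x i⌋₊) with hT
  have hcard : T.card = ∑ x ∈ (unitBox_finite hv).toFinset,
      if ⌊∑ i, x i⌋₊ ≤ n then (d + (n - ⌊∑ i, x i⌋₊)).choose d else 0 := by
    rw [hT, Finset.card_sigma, Finset.sum_filter]
    refine Finset.sum_congr rfl fun x _ => ?_
    rw [Finset.card_finsuppAntidiag_nat_eq_choose]
    simp only [Finset.card_univ, Fintype.card_fin]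
    rw [show d + 1 + (n - ⌊∑ i, x i⌋₊) - 1 = d + (n - ⌊∑ i, x i⌋₊) by omega, Nat.choose_symm_add]
  rw [← hcard]
  set φ : (Σ _ : Fin (d + 1) → ℝ, Fin (d + 1) →₀ ℕ) → Fin (d + 1) → ℝ :=
    fun q i => q.1 i + q.2 i with hφ
  have himg : dilateCoefficients v n = φ '' (T : Set _) := by
    ext c
    constructor
    · rintro ⟨hL, hc, hs⟩
      have hfl : ∀ i, ((⌊c i⌋.toNat : ℕ) : ℝ) = ⌊c i⌋ := fun i => by
        exact_mod_cast Int.toNat_of_nonneg (Int.floor_nonneg.2 (hc i))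
      have hbox : (fun i => Int.fract (c i)) ∈ unitBox (relLattice v) := by
        refine ⟨?_, fun i => ⟨Int.fract_nonneg _, Int.fract_lt_one _⟩⟩
        have : (fun i => Int.fract (c i)) = c - fun i => ((⌊c i⌋ : ℤ) : ℝ) := by
          ext i; exact (Int.self_sub_floor (c i)).symm
        rw [this]
        exact AddSubgroup.sub_mem _ hL (intCast_mem_relLattice v _)
      have hht := cast_floor_sum_of_mem_unitBox hbox
      have hsum : ⌊∑ i, Int.fract (c i)⌋₊ + ∑ i, ⌊c i⌋.toNat = n := by
        have : (⌊∑ i, Int.fract (c i)⌋₊ : ℝ) + ∑ i, (⌊c i⌋.toNat : ℝ) = n := by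
          rw [hht, ← hs, ← Finset.sum_add_distrib]
          refine Finset.sum_congr rfl fun i _ => ?_
          rw [hfl, Int.fract_add_floor]
        exact_mod_cast this
      refine ⟨⟨fun i => Int.fract (c i), Finsupp.equivFunOnFinite.symm fun i => ⌊c i⌋.toNat⟩,
        ?_, ?_⟩
      · simp only [hT, Finset.mem_coe, Finset.mem_sigma, Finset.mem_filter,
          Set.Finite.mem_toFinset, Finset.mem_finsuppAntidiag]
        refine ⟨⟨hbox, by omega⟩, ?_, Finset.subset_univ _⟩
        simp only [Finsupp.equivFunOnFinite_symm_apply_apply]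
        omega
      · ext i
        simp only [hφ, Finsupp.equivFunOnFinite_symm_apply_apply]
        rw [hfl, Int.fract_add_floor]
    · rintro ⟨⟨x, f⟩, hq, rfl⟩
      simp only [hT, Finset.mem_coe, Finset.mem_sigma, Finset.mem_filter,
        Set.Finite.mem_toFinset, Finset.mem_finsuppAntidiag] at hq
      obtain ⟨⟨hx, hle⟩, hf, _⟩ := hq
      refine ⟨?_, fun i => add_nonneg (hx.2 i).1 (Nat.cast_nonneg _), ?_⟩
      · have := intCast_mem_relLattice v fun i => (f i : ℤ)
        simp only [Int.cast_natCast] at this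
        exact AddSubgroup.add_mem _ hx.1 this
      · simp only [hφ]
        rw [Finset.sum_add_distrib, ← cast_floor_sum_of_mem_unitBox hx, ← Nat.cast_sum, hf,
          ← Nat.cast_add, Nat.add_sub_cancel' hle]
  rw [himg, Set.InjOn.ncard_image, Set.ncard_coe_finset]
  rintro ⟨x, f⟩ hq ⟨x', f'⟩ hq' heq
  simp only [hT, Finset.mem_coe, Finset.mem_sigma, Finset.mem_filter,
    Set.Finite.mem_toFinset] at hq hq'
  have hx : ∀ i, x i = x' i ∧ f i = f' i := by
    intro i
    have h1 : x i + f i = x' i + f' i := congrFun heq i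
    have h2 := congrArg Int.fract h1
    rw [Int.fract_add_natCast, Int.fract_add_natCast, Int.fract_eq_self.2 (hq.1.1.2 i),
      Int.fract_eq_self.2 (hq'.1.1.2 i)] at h2
    rw [h2] at h1
    exact ⟨h2, by exact_mod_cast add_left_cancel h1⟩
  obtain rfl : x = x' := funext fun i => (hx i).1
  obtain rfl : f = f' := Finsupp.ext fun i => (hx i).2
  rfl

/-- The `δ`-polynomial of a lattice simplex enumerates the points of its half-open fundamental
box by height. -/
theorem deltaSeries_convexHull (hv : AffineIndependent ℝ fun i => toReal (v i)) :
    deltaSeries (convexHull ℝ (Set.range fun i => toReal (v i))) =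
      ∑ x ∈ (unitBox_finite hv).toFinset, (PowerSeries.X : PowerSeries ℤ) ^ ⌊∑ i, x i⌋₊ := by
  have hcount : (PowerSeries.mk fun n => if n = 0 then 1 else
      (latticeCount (convexHull ℝ (Set.range fun i => toReal (v i))) n : ℤ)) =
      (∑ x ∈ (unitBox_finite hv).toFinset, (PowerSeries.X : PowerSeries ℤ) ^ ⌊∑ i, x i⌋₊) *
        PowerSeries.mk fun n => ((d + n).choose d : ℤ) := by
    -- The zeroth dilate contains only the origin, so the separately prescribed constant term 1
    -- agrees with the general count.
    have h0 : latticeCount (convexHull ℝ (Set.range fun i => toReal (v i))) 0 = 1 := by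
      rw [latticeCount, Nat.cast_zero, Set.zero_smul_set (Set.range_nonempty _).convexHull,
        Set.inter_eq_left.2, ← Set.singleton_zero, Set.ncard_singleton]
      rintro _ rfl
      exact ⟨0, by ext; simp [toReal]⟩
    ext n
    have hn : (if n = 0 then 1 else
        (latticeCount (convexHull ℝ (Set.range fun i => toReal (v i))) n : ℤ)) =
        latticeCount (convexHull ℝ (Set.range fun i => toReal (v i))) n := by
      split_ifs with h
      · rw [h, h0, Nat.cast_one]
      · rfl
    rw [PowerSeries.coeff_mk, hn, latticeCount_eq_ncard hv, ncard_dilateCoefficients hv,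
      Finset.sum_mul, map_sum]
    push_cast
    refine Finset.sum_congr rfl fun x _ => ?_
    rw [PowerSeries.coeff_X_pow_mul', PowerSeries.coeff_mk]
  rw [deltaSeries, hcount, mul_comm, mul_assoc]
  have h := PowerSeries.mk_add_choose_mul_one_sub_pow_eq_one ℤ d
  rw [h, mul_one]

end

/-! ### Lattices with prescribed heights of box points. -/

section

variable {ι : Type*} [Fintype ι]

theorem fract_mem_unitBox {ι : Type*} {L : AddSubgroup (ι → ℝ)}
    (hZ : ∀ f : ι → ℤ, (fun i => (f i : ℝ)) ∈ L) {c : ι → ℝ} (hc : c ∈ L) :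
    (fun i => Int.fract (c i)) ∈ unitBox L := by
  refine ⟨?_, fun i => ⟨Int.fract_nonneg _, Int.fract_lt_one _⟩⟩
  have : (fun i => Int.fract (c i)) = c - fun i => ((⌊c i⌋ : ℤ) : ℝ) := by
    ext i; exact (Int.self_sub_floor (c i)).symm
  rw [this]
  exact AddSubgroup.sub_mem _ hc (hZ _)

/-- The integer z = qt satisfies (q-1)z < q, which fails for z ≥ 2 because 2(q-1) ≥ q. -/
theorem eq_zero_or_eq_one_div {q t : ℝ} (hq : 2 ≤ q) (h0 : 0 ≤ t) (hz : ∃ z : ℤ, q * t = z)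
    (h1 : (q - 1) * t < 1) : t = 0 ∨ t = 1 / q := by
  obtain ⟨z, hz⟩ := hz
  have hq0 : q ≠ 0 := by positivity
  have hz0 : (0 : ℝ) ≤ z := hz ▸ mul_nonneg (by positivity) h0
  have hz2 : (z : ℝ) < 2 := by
    have h2 : (q - 1) * z < q := by
      rw [← hz]
      calc (q - 1) * (q * t) = q * ((q - 1) * t) := by ring
        _ < q * 1 := by gcongr
        _ = q := mul_one _
    by_contra hcon
    push Not at hcon
    nlinarith
  have hz0' : 0 ≤ z := by exact_mod_cast hz0
  have hz2' : z < 2 := by exact_mod_cast hz2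
  interval_cases z
  · left
    simpa [hq0] using hz
  · right
    rw [eq_div_iff hq0, mul_comm, hz, Int.cast_one]

/-- Each fractional part is at most t_i, so equal sums force termwise equality. Applied to a
combination of generators whose height is exactly additive, it shows that no coordinate wraps
around. -/
theorem lt_one_of_sum_fract_eq {t : ι → ℝ} (ht : ∀ i, 0 ≤ t i)
    (h : ∑ i, Int.fract (t i) = ∑ i, t i) (i : ι) : t i < 1 := by
  have hle : ∀ i ∈ Finset.univ, Int.fract (t i) ≤ t i := fun i _ => by
    have h1 := Int.fract_add_floor (t i)
    have h2 : (0 : ℝ) ≤ ⌊t i⌋ := by exact_mod_cast Int.floor_nonneg.2 (ht i)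
    linarith
  have := (Finset.sum_eq_sum_iff_of_le hle).1 h i (Finset.mem_univ i)
  rw [← this]
  exact Int.fract_lt_one _

/-- Generators of a lattice between `ℤ^ι` and `ℝ^ι` whose unit box has exactly one point of
each height `0, m, …, (p² - 1) m`. -/
theorem exists_lattice_generators {L : AddSubgroup (ι → ℝ)}
    (hZ : ∀ f : ι → ℤ, (fun i => (f i : ℝ)) ∈ L) {p m : ℕ} (hp : p.Prime) (hm : 0 < m)
    (hht : ∀ c ∈ unitBox L, ∃ j < p ^ 2, ∑ i, c i = (j : ℝ) * m)
    (hsurj : ∀ j < p ^ 2, ∃ c ∈ unitBox L, ∑ i, c i = (j : ℝ) * m)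
    (hinj : ∀ c ∈ unitBox L, ∀ c' ∈ unitBox L, ∑ i, c i = ∑ i, c' i → c = c') :
    (∃ x ∈ L, (∀ i, 0 ≤ x i) ∧ ∑ i, x i = m ∧ (∀ i, ∃ z : ℤ, (p : ℝ) ^ 2 * x i = z) ∧
      (∀ i, ((p : ℝ) ^ 2 - 1) * x i < 1) ∧
      ∀ c ∈ L, ∃ a : ℕ, ∀ i, ∃ z : ℤ, c i = a * x i + z) ∨
    (∃ x ∈ L, ∃ y ∈ L, (∀ i, 0 ≤ x i) ∧ (∀ i, 0 ≤ y i) ∧ ∑ i, x i = m ∧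
      ∑ i, y i = (p : ℝ) * m ∧ (∀ i, ∃ z : ℤ, p * x i = z) ∧
      (∃ j < p, ∀ i, ∃ z : ℤ, p * y i = (j : ℕ) * x i + z) ∧
      (∀ i, ((p : ℝ) - 1) * (y i + x i) < 1) ∧
      ∀ c ∈ L, ∃ a b : ℕ, ∀ i, ∃ z : ℤ, c i = a * y i + b * x i + z) := by
  have hm' : (m : ℝ) ≠ 0 := by positivity
  -- The copy of ℤ^ι inside L.
  let N : AddSubgroup L :=
    { carrier := {c | ∀ i, ∃ z : ℤ, c.1 i = z}
      zero_mem' := fun i => ⟨0, by simp⟩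
      add_mem' := fun {a b} ha hb i => by
        obtain ⟨z, hz⟩ := ha i
        obtain ⟨w, hw⟩ := hb i
        exact ⟨z + w, by simp [hz, hw]⟩
      neg_mem' := fun {a} ha i => by
        obtain ⟨z, hz⟩ := ha i
        exact ⟨-z, by simp [hz]⟩ }
  have hmk : ∀ a b : L, (a : L ⧸ N) = b ↔ ∀ i, Int.fract (a.1 i) = Int.fract (b.1 i) := by
    intro a b
    rw [eq_comm, QuotientAddGroup.eq]
    refine forall_congr' fun i => ?_
    rw [Int.fract_eq_fract]
    refine exists_congr fun z => ?_
    have : (-b + a : L).1 i = a.1 i - b.1 i := by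
      simp [sub_eq_neg_add]
    rw [this]
  have hex : ∀ c : L, ∃ j : ℕ, j < p ^ 2 ∧ ∑ i, Int.fract (c.1 i) = (j : ℝ) * m := fun c => by
    obtain ⟨j, hj, h⟩ := hht _ (fract_mem_unitBox hZ c.2)
    exact ⟨j, hj, h⟩
  choose ht htlt hteq using hex
  -- The height divided by m. It is read off a chosen representative; `key` shows that any
  -- representative gives the same value.
  let h : L ⧸ N → ℕ := fun q => ht q.out
  have key : ∀ c : L, (h c : ℝ) * m = ∑ i, Int.fract (c.1 i) := by
    intro c
    rw [← hteq]
    have h1 : ((c : L ⧸ N).out : L ⧸ N) = c := Quotient.out_eq _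
    rw [hmk] at h1
    exact Finset.sum_congr rfl fun i _ => h1 i
  have h0 : h 0 = 0 := by
    have h1 := key 0
    simp only [ZeroMemClass.coe_zero, Pi.zero_apply, Int.fract_zero, Finset.sum_const_zero,
      mul_eq_zero, hm', or_false] at h1
    exact_mod_cast h1
  have hadd : ∀ a b, h (a + b) ≤ h a + h b := by
    intro a b
    induction a using QuotientAddGroup.induction_on with | H a => ?_
    induction b using QuotientAddGroup.induction_on with | H b => ?_
    have h1 : (h ((a + b : L) : L ⧸ N) : ℝ) * m ≤ (h a + h b : ℝ) * m := by
      rw [add_mul, key, key, key, ← Finset.sum_add_distrib]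
      exact Finset.sum_le_sum fun i _ => Int.fract_add_le _ _
    have h2 := le_of_mul_le_mul_right h1 (by positivity)
    exact_mod_cast h2
  have hinj' : Function.Injective h := by
    intro a b hab
    induction a using QuotientAddGroup.induction_on with | H a => ?_
    induction b using QuotientAddGroup.induction_on with | H b => ?_
    rw [hmk]
    exact fun i => congrFun (hinj _ (fract_mem_unitBox hZ a.2) _ (fract_mem_unitBox hZ b.2)
      (by rw [← key, ← key, hab])) i
  have hran : ∀ a, (∃ q, h q = a) ↔ a < p ^ 2 := by
    intro a
    constructor
    · rintro ⟨q, rfl⟩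
      exact htlt _
    · intro ha
      obtain ⟨c, hc, hca⟩ := hsurj a ha
      refine ⟨((⟨c, hc.1⟩ : L) : L ⧸ N), ?_⟩
      have h1 := key ⟨c, hc.1⟩
      simp only [fun i => Int.fract_eq_self.2 (hc.2 i)] at h1
      rw [hca] at h1
      exact_mod_cast mul_right_cancel₀ hm' h1
  have hrep : ∀ q : L ⧸ N, ∃ c : L, (c : L ⧸ N) = q ∧ (∀ i, 0 ≤ c.1 i) ∧
      ∑ i, c.1 i = (h q : ℝ) * m := by
    intro q
    induction q using QuotientAddGroup.induction_on with | H c => ?_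
    refine ⟨⟨_, (fract_mem_unitBox hZ c.2).1⟩, ?_, fun i => Int.fract_nonneg _, (key c).symm⟩
    rw [hmk]
    exact fun i => Int.fract_fract _
  have hp1 : (1 : ℝ) ≤ p := by exact_mod_cast hp.one_le
  have hp2 : 1 ≤ p ^ 2 := Nat.one_le_pow _ _ hp.pos
  rcases exists_generators_of_subadditive_bijection hp h0 hadd hinj' hran with
    ⟨x, hgen, hpx, hx⟩ | ⟨x, y, hpx, ⟨j, hj, hpy⟩, hgen, hxy⟩
  · left
    have hx1 : h x = 1 := by simpa using hx 1 (by nlinarith [hp.two_le])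
    obtain ⟨x, rfl, hx0, hxs⟩ := hrep x
    refine ⟨x.1, x.2, hx0, by simpa [hx1] using hxs, fun i => ?_, ?_, fun c hc => ?_⟩
    · have h1 := (hmk (p ^ 2 • x) 0).1 hpx i
      obtain ⟨z, hz⟩ := Int.fract_eq_fract.1 h1
      exact ⟨z, by simpa using hz⟩
    -- The largest multiple p² - 1 still has additive height, which gives the strongest bound on the
    -- coordinates.
    · have h1 := key ((p ^ 2 - 1) • x)
      have h2 : h (((p ^ 2 - 1) • x : L) : L ⧸ N) = p ^ 2 - 1 := hx _ (by omega)
      rw [h2] at h1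
      refine lt_one_of_sum_fract_eq (fun i => mul_nonneg ?_ (hx0 i)) ?_
      · nlinarith
      · rw [← Finset.mul_sum, hxs, hx1]
        push_cast [Nat.cast_sub hp2] at h1
        simp only [Pi.smul_apply, nsmul_eq_mul] at h1
        push_cast [Nat.cast_sub hp2] at h1
        rw [← h1]
        simp
    · obtain ⟨a, ha⟩ := hgen ((⟨c, hc⟩ : L) : L ⧸ N)
      refine ⟨a, fun i => ?_⟩
      obtain ⟨z, hz⟩ := Int.fract_eq_fract.1 ((hmk ⟨c, hc⟩ (a • x)).1 ha i)
      refine ⟨z, ?_⟩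
      simp only [AddSubgroupClass.coe_nsmul, Pi.smul_apply, nsmul_eq_mul] at hz
      linarith
  · right
    have hx1 : h x = 1 := by simpa using hxy 0 hp.pos 1 hp.one_lt
    have hy1 : h y = p := by simpa using hxy 1 hp.one_lt 0 hp.pos
    obtain ⟨x, rfl, hx0, hxs⟩ := hrep x
    obtain ⟨y, rfl, hy0, hys⟩ := hrep y
    refine ⟨x.1, x.2, y.1, y.2, hx0, hy0, by simpa [hx1] using hxs, by rw [hys, hy1],
      fun i => ?_, ⟨j, hj, fun i => ?_⟩, ?_, fun c hc => ?_⟩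
    · have h1 := (hmk (p • x) 0).1 hpx i
      obtain ⟨z, hz⟩ := Int.fract_eq_fract.1 h1
      exact ⟨z, by simpa using hz⟩
    · obtain ⟨z, hz⟩ := Int.fract_eq_fract.1 ((hmk (p • y) (j • x)).1 hpy i)
      refine ⟨z, ?_⟩
      simp only [AddSubgroupClass.coe_nsmul, Pi.smul_apply, nsmul_eq_mul] at hz
      linarith
    · have hpos := hp.pos
      -- Both digits are maximal, so this element has the top value p² - 1, and its height is still
      -- additive.
      have h1 := key ((p - 1) • y + (p - 1) • x)
      have h2 : h (((p - 1) • y + (p - 1) • x : L) : L ⧸ N) = (p - 1) * p + (p - 1) :=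
        hxy _ (by omega) _ (by omega)
      rw [h2] at h1
      refine lt_one_of_sum_fract_eq
        (fun i => mul_nonneg (by linarith) (add_nonneg (hy0 i) (hx0 i))) ?_
      · rw [← Finset.mul_sum, Finset.sum_add_distrib, hxs, hx1, hys, hy1]
        simp only [AddSubgroup.coe_add, AddSubgroupClass.coe_nsmul, Pi.add_apply, Pi.mul_apply,
          Pi.sub_apply, Pi.natCast_apply, Pi.one_apply, nsmul_eq_mul, Nat.cast_add, Nat.cast_mul,
          Nat.cast_pred hpos, ← mul_add] at h1
        rw [← h1]
        push_cast
        ring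
    · obtain ⟨a, b, hab⟩ := hgen ((⟨c, hc⟩ : L) : L ⧸ N)
      refine ⟨a, b, fun i => ?_⟩
      obtain ⟨z, hz⟩ := Int.fract_eq_fract.1 ((hmk ⟨c, hc⟩ (a • y + b • x)).1 hab i)
      refine ⟨z, ?_⟩
      simp only [AddSubgroup.coe_add, AddSubgroupClass.coe_nsmul, Pi.add_apply,
        nsmul_eq_mul, Pi.mul_apply, Pi.natCast_apply] at hz
      linarith

/-- Lattices between `ℤ^ι` and `ℝ^ι` with no integral coordinate whose unit box has exactly one
point of each height `0, m, …, (p² - 1) m`. -/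
theorem lattice_classification {L : AddSubgroup (ι → ℝ)}
    (hZ : ∀ f : ι → ℤ, (fun i => (f i : ℝ)) ∈ L) {p m : ℕ} (hp : p.Prime) (hm : 0 < m)
    (hht : ∀ c ∈ unitBox L, ∃ j < p ^ 2, ∑ i, c i = (j : ℝ) * m)
    (hsurj : ∀ j < p ^ 2, ∃ c ∈ unitBox L, ∑ i, c i = (j : ℝ) * m)
    (hinj : ∀ c ∈ unitBox L, ∀ c' ∈ unitBox L, ∑ i, c i = ∑ i, c' i → c = c')
    (hfull : ∀ i, ∃ c ∈ L, ∀ z : ℤ, c i ≠ z) :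
    (Fintype.card ι = p ^ 2 * m ∧
      ∀ c, c ∈ L ↔ ∃ a : ℤ, ∀ i, ∃ z : ℤ, c i = a / p ^ 2 + z) ∨
    (∃ S : Set ι, S.ncard = p * m ∧ Fintype.card ι = p * m + (p ^ 2 - 1) * m ∧
      ∀ c, c ∈ L ↔ ∃ a : ℤ, (∀ i ∈ S, ∃ z : ℤ, c i = a / p ^ 2 + z) ∧
        ∀ i ∉ S, ∃ z : ℤ, c i = a / p + z) ∨
    (∃ S : Set ι, S.ncard = p * m ∧ Fintype.card ι = p * m + p ^ 2 * m ∧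
      ∀ c, c ∈ L ↔ ∃ a b : ℤ, (∀ i ∈ S, ∃ z : ℤ, c i = a / p + z) ∧
        ∀ i ∉ S, ∃ z : ℤ, c i = b / p + z) := by
  have hp2 : (2 : ℝ) ≤ p := by exact_mod_cast hp.two_le
  have hp0 : (p : ℝ) ≠ 0 := by positivity
  have hcong : ∀ c c' : ι → ℝ, c' ∈ L → (∀ i, ∃ z : ℤ, c i = c' i + z) → c ∈ L := by
    intro c c' hc' h
    choose f hf using h
    have : c = c' + fun i => (f i : ℝ) := funext hf
    rw [this]
    exact L.add_mem hc' (hZ f)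
  rcases exists_lattice_generators hZ hp hm hht hsurj hinj with
    ⟨x, hxL, hx0, hxs, hxz, hx1, hgen⟩ |
    ⟨x, hxL, y, hyL, hx0, hy0, hxs, hys, hxz, ⟨j, hj, hjz⟩, hxy1, hgen⟩
  · left
    have hx : ∀ i, x i = 1 / (p : ℝ) ^ 2 := by
      intro i
      refine (eq_zero_or_eq_one_div (by nlinarith) (hx0 i) (hxz i) (hx1 i)).resolve_left ?_
      intro hxi
      obtain ⟨c, hc, hcz⟩ := hfull i
      obtain ⟨a, ha⟩ := hgen c hc
      obtain ⟨w, hw⟩ := ha i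
      exact hcz w (by rw [hw, hxi]; ring)
    refine ⟨?_, fun c => ⟨fun hc => ?_, ?_⟩⟩
    · simp only [hx, Finset.sum_const, Finset.card_univ, nsmul_eq_mul] at hxs
      have : (Fintype.card ι : ℝ) = p ^ 2 * m := by
        field_simp at hxs
        linarith
      exact_mod_cast this
    · obtain ⟨a, ha⟩ := hgen c hc
      refine ⟨a, fun i => ?_⟩
      obtain ⟨z, hz⟩ := ha i
      exact ⟨z, by rw [hz, hx, Int.cast_natCast]; ring⟩
    · rintro ⟨a, ha⟩
      refine hcong c (a • x) (L.zsmul_mem hxL a) fun i => ?_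
      obtain ⟨z, hz⟩ := ha i
      exact ⟨z, by rw [hz, Pi.smul_apply, hx, zsmul_eq_mul]; ring⟩
  · right
    have hx : ∀ i, x i = 0 ∨ x i = 1 / p := by
      intro i
      refine eq_zero_or_eq_one_div hp2 (hx0 i) (hxz i) (lt_of_le_of_lt ?_ (hxy1 i))
      nlinarith [hy0 i]
    -- Where x vanishes, p·y_i is integral; y_i = 0 is excluded, since the coordinate would then be
    -- integral on all of L.
    have hyx0 : ∀ i, x i = 0 → y i = 1 / p := by
      intro i hxi
      have hyz : ∃ z : ℤ, p * y i = z := by simpa [hxi] using hjz i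
      refine (eq_zero_or_eq_one_div hp2 (hy0 i) hyz
        (by simpa [hxi] using hxy1 i)).resolve_left ?_
      intro hyi
      obtain ⟨c, hc, hcz⟩ := hfull i
      obtain ⟨a, b, ha⟩ := hgen c hc
      obtain ⟨w, hw⟩ := ha i
      exact hcz w (by rw [hw, hxi, hyi]; ring)
    -- Here the no-wrap bound becomes (p-1)(p·y_i) < 1. Hence p·y_i < 1 equals its residue j/p, and
    -- (p-1)j < p leaves only j = 0 or 1.
    have hyx1 : ∀ i, x i = 1 / p → y i = j / p ^ 2 ∧ j < 2 := by
      intro i hxi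
      have h1 := hxy1 i
      rw [hxi] at h1
      have h2 : ((p : ℝ) - 1) * (p * y i) < 1 := by
        have h3 : p * (((p : ℝ) - 1) * (y i + 1 / p)) < p * 1 := by gcongr
        have h4 : p * (((p : ℝ) - 1) * (y i + 1 / p)) = (p - 1) * (p * y i) + (p - 1) := by
          field_simp
        linarith
      have h0 : 0 ≤ p * y i := mul_nonneg (by positivity) (hy0 i)
      have h3 : p * y i < 1 := by nlinarith
      have hj' : (j : ℝ) < p := by exact_mod_cast hj
      obtain ⟨z, hz⟩ := hjz i
      have h4 : p * y i = j / p := by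
        have h5 : Int.fract (p * y i) = Int.fract (j / p : ℝ) :=
          Int.fract_eq_fract.2 ⟨z, by rw [hz, hxi]; ring⟩
        rwa [Int.fract_eq_self.2 ⟨h0, h3⟩, Int.fract_eq_self.2 ⟨by positivity, by
          rwa [div_lt_one (by positivity)]⟩] at h5
      refine ⟨by rw [eq_div_iff (by positivity)]; field_simp at h4; linarith, ?_⟩
      rw [h4] at h2
      have h5 : ((p : ℝ) - 1) * j < p := by
        rwa [← mul_div_assoc, div_lt_one (by positivity)] at h2
      have : (j : ℝ) < 2 := by
        by_contra hcon
        push Not at hcon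
        nlinarith
      exact_mod_cast this
    classical
    let S : Finset ι := Finset.univ.filter fun i => x i = 1 / p
    have hSmem : ∀ i, i ∈ (S : Set ι) ↔ x i = 1 / p := fun i => by simp [S]
    have hSnot : ∀ i, i ∉ (S : Set ι) → x i = 0 := fun i hi =>
      (hx i).resolve_right fun h => hi ((hSmem i).2 h)
    have hScard : S.card = p * m := by
      have h1 : ∑ i, x i = S.card * (1 / p) := by
        rw [← nsmul_eq_mul, ← Finset.sum_const, Finset.sum_filter]
        refine Finset.sum_congr rfl fun i _ => ?_
        split_ifs with h
        · exact h
        · exact (hx i).resolve_right h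
      rw [hxs] at h1
      have : (S.card : ℝ) = p * m := by
        field_simp at h1
        linarith
      exact_mod_cast this
    have hcardc : S.card + Sᶜ.card = Fintype.card ι := Finset.card_add_card_compl S
    have hysum : ∑ i, y i = S.card * (j / p ^ 2 : ℝ) + Sᶜ.card * (1 / p : ℝ) := by
      rw [← Finset.sum_add_sum_compl S, ← nsmul_eq_mul, ← nsmul_eq_mul, ← Finset.sum_const,
        ← Finset.sum_const]
      congr 1
      · exact Finset.sum_congr rfl fun i hi => (hyx1 i ((hSmem i).1 hi)).1
      · exact Finset.sum_congr rfl fun i hi =>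
          hyx0 i (hSnot i (by simpa using hi))
    have hj2 : j < 2 := by
      have : S.Nonempty := Finset.card_pos.1 (by rw [hScard]; exact Nat.mul_pos hp.pos hm)
      obtain ⟨i, hi⟩ := this
      exact (hyx1 i ((hSmem i).1 hi)).2
    rw [hys, hScard] at hysum
    -- The height of y reads pm = pm·j/p² + |Sᶜ|/p, so |Sᶜ| = p²m - jm. For j = 0 the vector y
    -- vanishes on S and the group is (ℤ/p)²; for j = 1 it is cyclic, generated by y.
    interval_cases j
    · right
      have hc : Sᶜ.card = p ^ 2 * m := by
        have : (Sᶜ.card : ℝ) = p ^ 2 * m := by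
          push_cast at hysum
          field_simp at hysum
          linarith
        exact_mod_cast this
      refine ⟨S, by rw [Set.ncard_coe_finset, hScard], by rw [← hcardc, hScard, hc],
        fun c => ⟨fun hcL => ?_, ?_⟩⟩
      · obtain ⟨a, b, hab⟩ := hgen c hcL
        refine ⟨b, a, fun i hi => ?_, fun i hi => ?_⟩ <;> obtain ⟨z, hz⟩ := hab i
        · have h1 := (hSmem i).1 hi
          refine ⟨z, ?_⟩
          rw [hz, (hyx1 i h1).1, h1]
          push_cast
          ring
        · have h1 := hSnot i hi
          refine ⟨z, ?_⟩
          rw [hz, hyx0 i h1, h1]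
          push_cast
          ring
      · rintro ⟨b, a, h1, h2⟩
        refine hcong c (a • y + b • x) (L.add_mem (L.zsmul_mem hyL a) (L.zsmul_mem hxL b))
          fun i => ?_
        simp only [Pi.add_apply, Pi.mul_apply, Pi.intCast_apply, zsmul_eq_mul]
        by_cases hi : i ∈ (S : Set ι)
        · obtain ⟨z, hz⟩ := h1 i hi
          refine ⟨z, ?_⟩
          have h3 := (hSmem i).1 hi
          rw [hz, (hyx1 i h3).1, h3]
          push_cast
          ring
        · obtain ⟨z, hz⟩ := h2 i hi
          refine ⟨z, ?_⟩
          have h3 := hSnot i hi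
          rw [hz, hyx0 i h3, h3]
          ring
    · left
      have hc : Sᶜ.card = (p ^ 2 - 1) * m := by
        have : (Sᶜ.card : ℝ) = (p ^ 2 - 1) * m := by
          push_cast at hysum
          field_simp at hysum
          linarith
        have h1 : ((p ^ 2 - 1 : ℕ) : ℝ) = (p : ℝ) ^ 2 - 1 := by
          rw [Nat.cast_sub (Nat.one_le_pow _ _ hp.pos)]
          push_cast
          rfl
        rw [← h1] at this
        exact_mod_cast this
      refine ⟨S, by rw [Set.ncard_coe_finset, hScard], by rw [← hcardc, hScard, hc],
        fun c => ⟨fun hcL => ?_, ?_⟩⟩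
      · obtain ⟨a, b, hab⟩ := hgen c hcL
        -- Here x ≡ p·y modulo ℤ^ι, so ay + bx ≡ (a + bp)y.
        refine ⟨a + b * p, fun i hi => ?_, fun i hi => ?_⟩ <;> obtain ⟨z, hz⟩ := hab i
        · have h1 := (hSmem i).1 hi
          refine ⟨z, ?_⟩
          rw [hz, (hyx1 i h1).1, h1]
          push_cast
          field_simp
        · have h1 := hSnot i hi
          refine ⟨z - b, ?_⟩
          rw [hz, hyx0 i h1, h1]
          push_cast
          field_simp
          ring
      · rintro ⟨a, h1, h2⟩
        refine hcong c (a • y) (L.zsmul_mem hyL a) fun i => ?_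
        simp only [Pi.smul_apply, zsmul_eq_mul]
        by_cases hi : i ∈ (S : Set ι)
        · obtain ⟨z, hz⟩ := h1 i hi
          refine ⟨z, ?_⟩
          have h3 := (hSmem i).1 hi
          rw [hz, (hyx1 i h3).1]
          push_cast
          ring
        · obtain ⟨z, hz⟩ := h2 i hi
          refine ⟨z, ?_⟩
          rw [hz, hyx0 i (hSnot i hi)]
          ring

end

/-! ### Unimodular equivalence from equality of relation lattices. -/

theorem toReal_vecMul {d : ℕ} (x : Fin d → ℤ) (U : Matrix (Fin d) (Fin d) ℤ) :
    toReal (x ᵥ* U) = toReal x ᵥ* U.map (fun z : ℤ => (z : ℝ)) := by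
  ext j
  simp [toReal, Matrix.vecMul, dotProduct]

theorem toReal_add {d : ℕ} (x y : Fin d → ℤ) : toReal (x + y) = toReal x + toReal y := by
  ext; simp [toReal]

theorem toReal_sub {d : ℕ} (x y : Fin d → ℤ) : toReal (x - y) = toReal x - toReal y := by
  ext; simp [toReal]

/-- The affine map `x ↦ x U + t`. -/
def latticeAffineMap {d : ℕ} (U : Matrix (Fin d) (Fin d) ℤ) (t : Fin d → ℤ) :
    (Fin d → ℝ) →ᵃ[ℝ] (Fin d → ℝ) :=
  (Matrix.vecMulLinear (U.map fun z : ℤ => (z : ℝ))).toAffineMap + AffineMap.const ℝ _ (toReal t)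

theorem latticeAffineMap_apply {d : ℕ} (U : Matrix (Fin d) (Fin d) ℤ) (t : Fin d → ℤ)
    (x : Fin d → ℝ) :
    latticeAffineMap U t x = x ᵥ* U.map (fun z : ℤ => (z : ℝ)) + toReal t := by
  simp [latticeAffineMap]

theorem latticeAffineMap_toReal {d : ℕ} (U : Matrix (Fin d) (Fin d) ℤ) (t x : Fin d → ℤ) :
    latticeAffineMap U t (toReal x) = toReal (x ᵥ* U + t) := by
  rw [latticeAffineMap_apply, toReal_add, toReal_vecMul]

theorem latticeAffineMap_injective {d : ℕ} {U : Matrix (Fin d) (Fin d) ℤ}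
    (hU : U.det = 1 ∨ U.det = -1) (t : Fin d → ℤ) :
    Function.Injective (latticeAffineMap U t) := by
  intro x y hxy
  rw [latticeAffineMap_apply, latticeAffineMap_apply, add_left_inj] at hxy
  refine Matrix.vecMul_injective_of_isUnit ?_ hxy
  exact ((Matrix.isUnit_iff_isUnit_det U).2 (Int.isUnit_iff.2 hU)).map
    (Int.castRingHom ℝ).mapMatrix

theorem unimodularlyEquivalent_convexHull {ι : Type*} {d : ℕ} {U : Matrix (Fin d) (Fin d) ℤ}
    (hU : U.det = 1 ∨ U.det = -1) {t : Fin d → ℤ} {v w : ι → Fin d → ℤ}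
    (h : ∀ i, w i = v i ᵥ* U + t) :
    UnimodularlyEquivalent (convexHull ℝ (Set.range fun i => toReal (v i)))
      (convexHull ℝ (Set.range fun i => toReal (w i))) := by
  refine ⟨U, t, hU, ?_⟩
  have h1 := (latticeAffineMap U t).image_convexHull (Set.range fun i => toReal (v i))
  rw [← Set.range_comp] at h1
  have h2 : (latticeAffineMap U t ∘ fun i => toReal (v i)) = fun i => toReal (w i) := by
    ext1 i
    rw [Function.comp_apply, latticeAffineMap_toReal, h]
  rw [h2] at h1
  rw [← h1]
  exact Set.image_congr fun x _ => latticeAffineMap_apply U t x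

theorem sum_single_sub_single_smul {ι E : Type*} [Fintype ι] [DecidableEq ι] [AddCommGroup E]
    [Module ℝ E] (f : ι → E) (j k : ι) :
    ∑ i, (Pi.single j 1 - Pi.single k 1 : ι → ℝ) i • f i = f j - f k := by
  simp [sub_smul, Finset.sum_sub_distrib, Pi.single_apply]

/-- Coefficient vectors of the standard unit vectors. -/
theorem exists_coefficient_basis {d : ℕ} {v : Fin (d + 1) → Fin d → ℤ}
    (hv : AffineIndependent ℝ fun i => toReal (v i)) :
    ∃ C : Fin d → Fin (d + 1) → ℝ, (∀ k, C k ∈ relLattice v) ∧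
      ∀ c : Fin (d + 1) → ℝ, ∑ i, c i = 0 →
        c = ∑ k, (∑ i, c i • toReal (v i)) k • C k := by
  choose C hC0 hC using fun k : Fin d => exists_coefficients hv 0 (toReal (Pi.single k 1))
  refine ⟨C, fun k => ⟨⟨0, by simp [hC0]⟩, _, hC k⟩, fun c hc => coefficients_ext hv ?_ ?_⟩
  · simp only [Finset.sum_apply, Pi.smul_apply]
    rw [Finset.sum_comm, hc]
    simp only [← Finset.smul_sum, hC0, smul_zero, Finset.sum_const_zero]
  · set x := ∑ i, c i • toReal (v i)
    simp only [Finset.sum_apply, Pi.smul_apply, Finset.sum_smul, smul_assoc]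
    rw [Finset.sum_comm]
    simp only [← Finset.smul_sum, hC]
    ext j
    simp [toReal, Pi.single_apply]

/-- The coefficient vectors expressing the unit vectors through the v_i lie in the relation lattice
of v, hence in that of w. Their combinations of the w_i are therefore integral and serve as the rows
of U. -/
theorem exists_integer_matrix {d : ℕ} {v w : Fin (d + 1) → Fin d → ℤ}
    (hv : AffineIndependent ℝ fun i => toReal (v i)) (h : relLattice v ≤ relLattice w) :
    ∃ U : Matrix (Fin d) (Fin d) ℤ, ∀ c : Fin (d + 1) → ℝ, ∑ i, c i = 0 →
      (∑ i, c i • toReal (v i)) ᵥ* U.map (fun z : ℤ => (z : ℝ)) = ∑ i, c i • toReal (w i) := by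
  obtain ⟨C, hC, hc⟩ := exists_coefficient_basis hv
  choose U hU using fun k => (h (hC k)).2
  refine ⟨Matrix.of U, fun c h0 => ?_⟩
  have h1 := hc c h0
  set x := ∑ i, c i • toReal (v i)
  rw [h1]
  simp only [Finset.sum_apply, Pi.smul_apply, Finset.sum_smul, smul_assoc]
  rw [Finset.sum_comm]
  simp only [← Finset.smul_sum, hU]
  ext j
  simp [toReal, Matrix.vecMul, dotProduct]

/-- Simplices with the same relation lattice are unimodularly equivalent. -/
theorem unimodularlyEquivalent_of_relLattice_eq {d : ℕ} {v w : Fin (d + 1) → Fin d → ℤ}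
    (hv : AffineIndependent ℝ fun i => toReal (v i))
    (hw : AffineIndependent ℝ fun i => toReal (w i)) (h : relLattice v = relLattice w) :
    UnimodularlyEquivalent (convexHull ℝ (Set.range fun i => toReal (v i)))
      (convexHull ℝ (Set.range fun i => toReal (w i))) := by
  obtain ⟨U, hU⟩ := exists_integer_matrix hv h.le
  obtain ⟨V, hV⟩ := exists_integer_matrix hw h.ge
  -- U and V carry the two combinations with the same zero-sum coefficients to each other, and every
  -- vector is such a combination.
  have hUV : U * V = 1 := by
    apply Matrix.map_injective (f := fun z : ℤ => (z : ℝ)) Int.cast_injective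
    change (Int.castRingHom ℝ).mapMatrix (U * V) = (Int.castRingHom ℝ).mapMatrix 1
    rw [map_mul, map_one]
    refine Matrix.ext_of_single_vecMul fun k => ?_
    obtain ⟨c, hc0, hc⟩ := exists_coefficients hv 0 (Pi.single k (1 : ℝ))
    rw [← Matrix.vecMul_vecMul, Matrix.vecMul_one, ← hc]
    exact (congrArg (· ᵥ* V.map fun z : ℤ => (z : ℝ)) (hU c hc0)).trans (hV c hc0)
  have hdet : U.det = 1 ∨ U.det = -1 := by
    apply Int.isUnit_iff.1
    exact IsUnit.of_mul_eq_one V.det (by rw [← Matrix.det_mul, hUV, Matrix.det_one])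
  refine unimodularlyEquivalent_convexHull hdet (t := w 0 - v 0 ᵥ* U) fun i => ?_
  have h1 := hU (Pi.single i 1 - Pi.single 0 1) (by simp)
  rw [sum_single_sub_single_smul (fun i => toReal (v i)),
    sum_single_sub_single_smul (fun i => toReal (w i)), ← toReal_sub, ← toReal_sub,
    ← toReal_vecMul] at h1
  have h2 : (v i - v 0) ᵥ* U = w i - w 0 := by
    ext j
    have h2 := congrFun h1 j
    simp only [toReal] at h2
    exact_mod_cast h2
  rw [Matrix.sub_vecMul] at h2
  rw [add_sub, add_comm, ← add_sub, h2]
  abel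

theorem relLattice_comp_equiv {ι : Type*} [Fintype ι] {d : ℕ} (v : ι → Fin d → ℤ)
    (σ : ι ≃ ι) (c : ι → ℝ) : c ∈ relLattice (v ∘ σ) ↔ c ∘ σ.symm ∈ relLattice v := by
  rw [mem_relLattice, mem_relLattice]
  have h1 : ∑ i, (c ∘ σ.symm) i = ∑ i, c i := Equiv.sum_comp σ.symm c
  have h2 : ∑ i, (c ∘ σ.symm) i • toReal (v i) = ∑ i, c i • toReal ((v ∘ σ) i) := by
    rw [← Equiv.sum_comp σ]
    simp
  rw [h1, h2]

theorem unimodularlyEquivalent_of_relLattice_perm {d : ℕ} {v w : Fin (d + 1) → Fin d → ℤ}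
    (hv : AffineIndependent ℝ fun i => toReal (v i))
    (hw : AffineIndependent ℝ fun i => toReal (w i)) (σ : Equiv.Perm (Fin (d + 1)))
    (h : ∀ c, c ∈ relLattice v ↔ c ∘ σ.symm ∈ relLattice w) :
    UnimodularlyEquivalent (convexHull ℝ (Set.range fun i => toReal (v i)))
      (convexHull ℝ (Set.range fun i => toReal (w i))) := by
  have h1 : (Set.range fun i => toReal (w i)) = Set.range fun i => toReal ((w ∘ σ) i) := by
    change _ = Set.range ((fun i => toReal (w i)) ∘ σ)
    rw [EquivLike.range_comp]
  rw [h1]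
  refine unimodularlyEquivalent_of_relLattice_eq hv (hw.comp_embedding σ.toEmbedding) ?_
  ext c
  rw [h, relLattice_comp_equiv]

/-! ### Integral coordinates and lattice pyramids. -/

/-- A lattice simplex for which some coordinate is integral on the whole relation lattice is a
lattice pyramid. -/
theorem isLatticePyramid_of_integral_coordinate {d : ℕ} {v : Fin (d + 2) → Fin (d + 1) → ℤ}
    (hv : AffineIndependent ℝ fun i => toReal (v i)) (i : Fin (d + 2))
    (hi : ∀ c ∈ relLattice v, ∃ z : ℤ, c i = z) :
    IsLatticePyramid (convexHull ℝ (Set.range fun i => toReal (v i))) := by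
  obtain ⟨i₀, hi₀⟩ := exists_ne i
  obtain ⟨C, hC, hc⟩ := exists_coefficient_basis hv
  choose a ha using fun k => hi _ (hC k)
  -- φ is the i-th coefficient of an integer vector written as a zero-sum combination of the
  -- vertices; it is integer-valued by `hi`. It is 1 at the apex direction v_i - v_{i₀} and 0 at
  -- every other edge from v_{i₀}.
  let φ : (Fin (d + 1) → ℤ) →ₗ[ℤ] ℤ := Fintype.linearCombination ℤ a
  have hφ : ∀ j, φ (v j - v i₀) = if i = j then 1 else 0 := by
    intro j
    have h1 := congrFun (hc (Pi.single j 1 - Pi.single i₀ 1) (by simp)) i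
    rw [sum_single_sub_single_smul (fun i => toReal (v i)), ← toReal_sub] at h1
    simp only [Finset.sum_apply, Pi.smul_apply, ha, Pi.sub_apply, Pi.single_apply, hi₀.symm,
      if_false, sub_zero, smul_eq_mul] at h1
    have h2 : ((φ (v j - v i₀) : ℤ) : ℝ) = ((if i = j then 1 else 0 : ℤ) : ℝ) := by
      simp only [φ, Fintype.linearCombination_apply, Pi.sub_apply, smul_eq_mul]
      push_cast
      rw [h1]
      simp [toReal]
    exact_mod_cast h2
  set y := v i - v i₀ with hy
  have hφy : φ y = 1 := by rw [hy, hφ, if_pos rfl]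
  obtain ⟨n, b⟩ := Submodule.basisOfPid (Pi.basisFun ℤ (Fin (d + 1))) (LinearMap.ker φ)
  have hli : ∀ c : ℤ, ∀ x ∈ LinearMap.ker φ, c • y + x = 0 → c = 0 := by
    intro c x hx h
    have := congrArg φ h
    rwa [map_add, map_smul, hφy, LinearMap.mem_ker.1 hx, map_zero, add_zero, smul_eq_mul,
      mul_one] at this
  have hsp : ∀ z, ∃ c : ℤ, z + c • y ∈ LinearMap.ker φ := fun z => ⟨-φ z, by
    rw [LinearMap.mem_ker, map_add, map_smul, hφy, smul_eq_mul, mul_one, add_neg_cancel]⟩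
  set B := Module.Basis.mkFinSnoc b y hli hsp with hB
  obtain rfl : n = d := by
    have h1 := Module.finrank_eq_card_basis B
    have h2 := Module.finrank_eq_card_basis (Pi.basisFun ℤ (Fin (d + 1)))
    rw [h1] at h2
    simpa using h2
  have hBlast : B (Fin.last n) = y := by simp [hB]
  have hφB : ∀ x, B.repr x (Fin.last n) = φ x := by
    intro x
    have h1 : φ = B.coord (Fin.last n) := by
      refine B.ext fun k => ?_
      refine Fin.lastCases ?_ (fun k => ?_) k
      · rw [hBlast, hφy, ← hBlast, Module.Basis.coord_apply, Module.Basis.repr_self]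
        simp
      · have h2 : B k.castSucc = b k := by simp [hB]
        rw [Module.Basis.coord_apply, Module.Basis.repr_self, h2, LinearMap.mem_ker.1 (b k).2]
        simp [Fin.castSucc_ne_last]
    rw [h1, Module.Basis.coord_apply]
  set U : Matrix (Fin (n + 1)) (Fin (n + 1)) ℤ := (B.toMatrix (Pi.basisFun ℤ _))ᵀ with hU
  have hdet : U.det = 1 ∨ U.det = -1 := by
    rw [hU, Matrix.det_transpose]
    exact Int.isUnit_iff.1 (B.isUnit_det (Pi.basisFun ℤ _))
  have hrepr : ∀ x, x ᵥ* U = B.repr x := by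
    intro x
    rw [hU, Matrix.vecMul_transpose]
    have h1 := Module.Basis.toMatrix_mulVec_repr (Pi.basisFun ℤ (Fin (n + 1))) B x
    have h2 : ((Pi.basisFun ℤ (Fin (n + 1))).repr x : Fin (n + 1) → ℤ) = x := by
      ext k; simp
    rwa [h2] at h1
  -- In the basis B, with v_{i₀} moved to the origin, the apex becomes (0,…,0,1) and the other
  -- vertices have last coordinate 0.
  let w : Fin (n + 2) → Fin (n + 1) → ℤ := fun j => v j ᵥ* U + -(v i₀ ᵥ* U)
  have hw : ∀ j, w j = B.repr (v j - v i₀) := by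
    intro j
    rw [← hrepr, Matrix.sub_vecMul, sub_eq_add_neg]
  have hwi : ∀ j, w j (Fin.last n) = if i = j then 1 else 0 := by
    intro j
    rw [hw, hφB, hφ]
  have hwapex : w i = Fin.snoc (α := fun _ => ℤ) (0 : Fin n → ℤ) 1 := by
    rw [hw, ← hy, ← hBlast, Module.Basis.repr_self]
    ext k
    refine Fin.lastCases ?_ (fun k => ?_) k
    · simp
    · simp [Fin.castSucc_ne_last]
  have hwind : AffineIndependent ℝ fun j => toReal (w j) := by
    have h1 := hv.map' (latticeAffineMap U (-(v i₀ ᵥ* U)))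
      (latticeAffineMap_injective hdet _)
    convert h1 using 1
    ext1 j
    rw [Function.comp_apply, latticeAffineMap_toReal]
  let q : Fin (n + 1) → Fin n → ℤ := fun j => Fin.init (α := fun _ => ℤ) (w (i.succAbove j))
  let S : (Fin n → ℝ) →ₗ[ℝ] (Fin (n + 1) → ℝ) :=
    { toFun := fun x => Fin.snoc (α := fun _ => ℝ) x 0
      map_add' := fun x y => by
        ext k
        refine Fin.lastCases ?_ (fun k => ?_) k <;> simp
      map_smul' := fun c x => by
        ext k
        refine Fin.lastCases ?_ (fun k => ?_) k <;> simp }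
  have hS : ∀ x, S x = Fin.snoc (α := fun _ => ℝ) x 0 := fun x => rfl
  have hSq : ∀ j, S (toReal (q j)) = toReal (w (i.succAbove j)) := by
    intro j
    rw [hS]
    ext k
    refine Fin.lastCases ?_ (fun k => ?_) k
    · simp [toReal, hwi, (Fin.succAbove_ne i j).symm]
    · simp [toReal, q, Fin.init]
  have hqind : AffineIndependent ℝ fun j => toReal (q j) := by
    refine AffineIndependent.of_comp S.toAffineMap ?_
    have h1 := hwind.comp_embedding i.succAboveEmb
    have h2 : (S.toAffineMap ∘ fun j => toReal (q j)) =
        (fun j => toReal (w j)) ∘ i.succAboveEmb := funext hSq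
    rw [h2]
    exact h1
  refine ⟨convexHull ℝ (Set.range fun j => toReal (q j)), ⟨q, hqind, rfl⟩, ?_⟩
  have hpyr : pyramid (convexHull ℝ (Set.range fun j => toReal (q j))) =
      convexHull ℝ (Set.range fun j => toReal (w j)) := by
    rw [pyramid]
    change convexHull ℝ (insert _ (S '' _)) = _
    rw [S.image_convexHull, Set.insert_eq, convexHull_convexHull_union_right, ← Set.insert_eq]
    congr 1
    have h1 : toReal (w i) = Fin.snoc (α := fun _ => ℝ) (0 : Fin n → ℝ) 1 := by
      rw [hwapex]
      ext k
      refine Fin.lastCases ?_ (fun k => ?_) k <;> simp [toReal]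
    rw [← h1, ← Set.range_comp]
    ext x
    constructor
    · rintro (rfl | ⟨j, rfl⟩)
      · exact ⟨i, rfl⟩
      · exact ⟨_, (hSq j).symm⟩
    · rintro ⟨j, rfl⟩
      rcases Fin.eq_self_or_eq_succAbove i j with rfl | ⟨k, rfl⟩
      · exact Or.inl rfl
      · exact Or.inr ⟨k, hSq k⟩
  rw [hpyr]
  exact unimodularlyEquivalent_convexHull hdet fun j => rfl

/-! ### The relation lattices of Δ(A) and Δ(B,C). -/

/-- The integers as a subgroup of the reals. -/
def integerSubgroup : AddSubgroup ℝ := (Int.castAddHom ℝ).range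

theorem mem_integerSubgroup {x : ℝ} : x ∈ integerSubgroup ↔ ∃ z : ℤ, x = z :=
  exists_congr fun _ => eq_comm

theorem intCast_mem_integerSubgroup (z : ℤ) : (z : ℝ) ∈ integerSubgroup :=
  mem_integerSubgroup.2 ⟨z, rfl⟩

theorem sub_mem_integerSubgroup {x y : ℝ} :
    x - y ∈ integerSubgroup ↔ ∃ z : ℤ, x = y + z := by
  rw [mem_integerSubgroup]
  simp only [sub_eq_iff_eq_add']

theorem intCast_mul_mem_integerSubgroup (a : ℤ) {x : ℝ} (hx : x ∈ integerSubgroup) :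
    a * x ∈ integerSubgroup := by
  rw [← zsmul_eq_mul]
  exact integerSubgroup.zsmul_mem hx a

theorem mem_relLattice_iff_integerSubgroup {ι : Type*} [Fintype ι] {d : ℕ} {v : ι → Fin d → ℤ}
    {c : ι → ℝ} : c ∈ relLattice v ↔
      ∑ i, c i ∈ integerSubgroup ∧ ∀ j, (∑ i, c i • toReal (v i)) j ∈ integerSubgroup := by
  rw [mem_relLattice]
  refine and_congr mem_integerSubgroup.symm ?_
  simp only [mem_integerSubgroup]
  constructor
  · rintro ⟨w, hw⟩ j
    exact ⟨w j, congrFun hw j⟩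
  · intro h
    choose w hw using h
    exact ⟨w, funext hw⟩

theorem sum_mem_integerSubgroup_congr {ι : Type*} [Fintype ι] {c u : ι → ℝ}
    (hu : ∑ i, u i ∈ integerSubgroup) (h : ∀ i, c i - u i ∈ integerSubgroup) :
    ∑ i, c i ∈ integerSubgroup := by
  have h1 := integerSubgroup.add_mem (integerSubgroup.sum_mem fun i (_ : i ∈ Finset.univ) => h i) hu
  rwa [Finset.sum_sub_distrib, sub_add_cancel] at h1

/-- Index 0 is the vertex at the origin, which contributes nothing to ∑ c_i v_i; its coefficient is
controlled only through the total sum. -/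
theorem zero_coordinate_mem_integerSubgroup {n : ℕ} {c u : Fin (n + 1) → ℝ}
    (hc : ∑ i, c i ∈ integerSubgroup) (hu : ∑ i, u i ∈ integerSubgroup)
    (h : ∀ i : Fin n, c i.succ - u i.succ ∈ integerSubgroup) :
    c 0 - u 0 ∈ integerSubgroup := by
  have h1 := integerSubgroup.sub_mem (integerSubgroup.sub_mem hc hu)
    (integerSubgroup.sum_mem fun i (_ : i ∈ Finset.univ) => h i)
  rw [← Finset.sum_sub_distrib, Fin.sum_univ_succ] at h1
  simpa using h1

/-- The vertices of `rowSimplex M`. -/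
def rowVertices {d : ℕ} (M : Matrix (Fin d) (Fin d) ℤ) : Fin (d + 1) → Fin d → ℤ :=
  Fin.cons 0 fun i => M i

theorem rowVertices_zero {d : ℕ} (M : Matrix (Fin d) (Fin d) ℤ) : rowVertices M 0 = 0 := rfl

theorem rowVertices_succ {d : ℕ} (M : Matrix (Fin d) (Fin d) ℤ) (i : Fin d) :
    rowVertices M i.succ = M i := rfl

theorem rowSimplex_eq_convexHull_rowVertices {d : ℕ} (M : Matrix (Fin d) (Fin d) ℤ) :
    rowSimplex M = convexHull ℝ (Set.range fun i => toReal (rowVertices M i)) := by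
  rw [rowSimplex]
  congr 1
  ext x
  simp only [Set.mem_insert_iff, Set.mem_range, Fin.exists_fin_succ, rowVertices_zero,
    rowVertices_succ]
  refine or_congr ?_ Iff.rfl
  have : toReal (0 : Fin d → ℤ) = 0 := by ext; simp [toReal]
  rw [this, eq_comm]

theorem sum_smul_rowVertices {d : ℕ} (M : Matrix (Fin d) (Fin d) ℤ) (c : Fin (d + 1) → ℝ)
    (j : Fin d) :
    (∑ i, c i • toReal (rowVertices M i)) j = ∑ i : Fin d, c i.succ * M i j := by
  rw [Fin.sum_univ_succ]
  simp [rowVertices_zero, rowVertices_succ, toReal]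

theorem affineIndependent_of_sum_smul_eq_zero {ι E : Type*} [Fintype ι] [AddCommGroup E]
    [Module ℝ E] {f : ι → E}
    (h : ∀ c : ι → ℝ, ∑ i, c i = 0 → ∑ i, c i • f i = 0 → ∀ i, c i = 0) :
    AffineIndependent ℝ f := by
  rw [affineIndependent_iff_of_fintype]
  intro c hc0 hc
  rw [Finset.weightedVSub_eq_linear_combination _ hc0] at hc
  exact h c hc0 hc

theorem rowVertices_affineIndependent {d : ℕ} {M : Matrix (Fin d) (Fin d) ℤ}
    (h : ∀ c : Fin d → ℝ, (∀ j, ∑ i, c i * M i j = 0) → ∀ i, c i = 0) :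
    AffineIndependent ℝ fun i => toReal (rowVertices M i) := by
  refine affineIndependent_of_sum_smul_eq_zero fun c hc0 hc => ?_
  have h1 := h (fun i => c i.succ) fun j => by
    rw [← sum_smul_rowVertices, hc, Pi.zero_apply]
  rw [Fin.sum_univ_succ, Finset.sum_eq_zero fun i _ => h1 i, add_zero] at hc0
  exact fun i => Fin.cases hc0 h1 i

theorem sum_mul_matrixA {n : ℕ} (A : Fin (n + 1) → ℤ) (c : Fin (n + 1) → ℝ) (j : Fin (n + 1)) :
    ∑ i, c i * matrixA A i j = if j = Fin.last n then c (Fin.last n) * A (Fin.last n)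
      else c j + c (Fin.last n) * (A (Fin.last n) - A j) := by
  have h : ∀ i, c i * (matrixA A i j : ℝ) =
      (if i = Fin.last n then
        c i * (if j = Fin.last n then (A (Fin.last n) : ℝ) else A (Fin.last n) - A j) else 0) +
      (if i = j then (if j = Fin.last n then 0 else c i) else 0) := by
    intro i
    have h1 : (i : ℕ) + 1 = n + 1 ↔ i = Fin.last n := by
      rw [Fin.ext_iff, Fin.val_last]; omega
    simp only [matrixA, Matrix.of_apply, h1]
    by_cases hi : i = Fin.last n
    · subst hi
      by_cases hj : j = Fin.last n
      · simp [hj]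
      · simp [hj, Ne.symm hj]
    · by_cases hj : j = i
      · subst hj; simp [hi]
      · simp [hi, hj, Ne.symm hj]
  rw [Finset.sum_congr rfl fun i _ => h i, Finset.sum_add_distrib, Finset.sum_ite_eq',
    Finset.sum_ite_eq']
  split_ifs <;> simp_all [add_comm]

theorem matrixA_affineIndependent {n : ℕ} {A : Fin (n + 1) → ℤ} (hA : A (Fin.last n) ≠ 0) :
    AffineIndependent ℝ fun i => toReal (rowVertices (matrixA A) i) := by
  refine rowVertices_affineIndependent fun c hc => ?_
  simp only [sum_mul_matrixA] at hc
  have h1 : c (Fin.last n) = 0 := by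
    have := hc (Fin.last n)
    rw [if_pos rfl] at this
    exact (mul_eq_zero.1 this).resolve_right (by exact_mod_cast hA)
  intro i
  by_cases hi : i = Fin.last n
  · rw [hi, h1]
  · have := hc i
    rwa [if_neg hi, h1, zero_mul, add_zero] at this

/-- With q the last entry of A, the last column gives c_last = a/q, and column j, whose entry in the
last row is q - A_j, gives c_j ≡ a·A_j/q modulo ℤ. The weight of the origin is fixed modulo q by
divisibility of the total. -/
theorem mem_relLattice_matrixA {n : ℕ} {A : Fin (n + 1) → ℤ} {α : Fin (n + 2) → ℤ}
    (hA : A (Fin.last n) ≠ 0) (hlast : α (Fin.last n).succ = 1)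
    (hα : ∀ j, j ≠ Fin.last n → α j.succ = A j) (hsum : A (Fin.last n) ∣ ∑ i, α i)
    (c : Fin (n + 2) → ℝ) :
    c ∈ relLattice (rowVertices (matrixA A)) ↔
      ∃ a : ℤ, ∀ i, ∃ z : ℤ, c i = a * α i / A (Fin.last n) + z := by
  set q := A (Fin.last n)
  have hq : (q : ℝ) ≠ 0 := by exact_mod_cast hA
  have hu : ∀ a : ℤ, ∑ i, (a * α i / q : ℝ) ∈ integerSubgroup := by
    intro a
    obtain ⟨e, he⟩ := hsum
    rw [← Finset.sum_div, ← Finset.mul_sum, ← Int.cast_sum, he, Int.cast_mul,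
      mul_left_comm, mul_div_cancel_left₀ _ hq, ← Int.cast_mul]
    exact intCast_mem_integerSubgroup _
  simp only [mem_relLattice_iff_integerSubgroup, sum_smul_rowVertices,
    sum_mul_matrixA A (fun i => c i.succ), ← sub_mem_integerSubgroup]
  constructor
  · rintro ⟨hs, hc⟩
    have h1 := hc (Fin.last n)
    rw [if_pos rfl, mem_integerSubgroup] at h1
    obtain ⟨a, ha⟩ := h1
    have hca : c (Fin.last n).succ = a / q := by rwa [eq_div_iff hq]
    have hsucc : ∀ i : Fin (n + 1), c i.succ - a * α i.succ / q ∈ integerSubgroup := by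
      intro i
      by_cases hi : i = Fin.last n
      · rw [hi, hlast, hca]
        simp [integerSubgroup.zero_mem]
      · have h2 := integerSubgroup.sub_mem (hc i) (intCast_mem_integerSubgroup a)
        rw [if_neg hi, hca] at h2
        rw [hα i hi]
        convert h2 using 1
        field_simp
        ring
    refine ⟨a, fun i => Fin.cases ?_ hsucc i⟩
    exact zero_coordinate_mem_integerSubgroup hs (hu a) hsucc
  · rintro ⟨a, h⟩
    refine ⟨sum_mem_integerSubgroup_congr (hu a) h, fun j => ?_⟩
    have h1 := h (Fin.last n).succ
    rw [hlast, Int.cast_one, mul_one] at h1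
    split_ifs with hj
    · have h2 := integerSubgroup.add_mem (intCast_mul_mem_integerSubgroup q h1)
        (intCast_mem_integerSubgroup a)
      convert h2 using 1
      field_simp
      ring
    · have h2 := h j.succ
      rw [hα j hj] at h2
      have h3 := integerSubgroup.add_mem
        (integerSubgroup.add_mem h2 (intCast_mul_mem_integerSubgroup (q - A j) h1))
        (intCast_mem_integerSubgroup a)
      convert h3 using 1
      push_cast
      field_simp
      ring

theorem sum_mul_matrixBC {n t : ℕ} (ht : t < n) (B : Fin (t + 1) → ℤ) (C : Fin (n + 1) → ℤ)
    (c : Fin (n + 1) → ℝ) (j : Fin (n + 1)) :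
    ∑ i, c i * matrixBC B C i j =
      c (Fin.last n) * (if j = Fin.last n then (C (Fin.last n) : ℝ) else C (Fin.last n) - C j) +
      c ⟨t, by omega⟩ * (if hj : (j : ℕ) < t then (B (Fin.last t) - B ⟨j, by omega⟩ : ℝ) else
        if (j : ℕ) = t then (B (Fin.last t) : ℝ) else 0) +
      (if j = Fin.last n ∨ (j : ℕ) = t then 0 else c j) := by
  set f : ℝ := if j = Fin.last n then (C (Fin.last n) : ℝ) else C (Fin.last n) - C j with hf
  set g : ℝ := if hj : (j : ℕ) < t then (B (Fin.last t) - B ⟨j, by omega⟩ : ℝ) else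
        if (j : ℕ) = t then (B (Fin.last t) : ℝ) else 0 with hg
  have h : ∀ i, c i * (matrixBC B C i j : ℝ) =
      (if i = Fin.last n then c i * f else 0) + (if i = ⟨t, by omega⟩ then c i * g else 0) +
      (if i = j then (if j = Fin.last n ∨ (j : ℕ) = t then 0 else c i) else 0) := by
    intro i
    have h1 : (i : ℕ) + 1 = n + 1 ↔ i = Fin.last n := by
      rw [Fin.ext_iff, Fin.val_last]; omega
    have h2 : (i : ℕ) + 1 = t + 1 ↔ i = ⟨t, by omega⟩ := by
      rw [Fin.ext_iff]; simp
    have h3 : Fin.last n ≠ ⟨t, by omega⟩ := by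
      rw [Ne, Fin.ext_iff, Fin.val_last]; dsimp only; omega
    by_cases hi : i = Fin.last n
    · subst hi
      rw [if_pos rfl, if_neg h3, add_zero]
      have h4 : (if Fin.last n = j then
          (if j = Fin.last n ∨ (j : ℕ) = t then 0 else c (Fin.last n)) else 0) = 0 := by
        split_ifs with h5 h6
        · rfl
        · exact absurd (Or.inl h5.symm) h6
        · rfl
      rw [h4, add_zero, hf]
      simp only [matrixBC, Matrix.of_apply, Fin.val_last, if_true]
      split_ifs <;> simp
    · by_cases hit : i = ⟨t, by omega⟩
      · have h4 : (if i = j then (if j = Fin.last n ∨ (j : ℕ) = t then 0 else c i) else 0) = 0 := by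
          split_ifs with h5 h6
          · rfl
          · exact absurd (Or.inr (by rw [← h5, hit])) h6
          · rfl
        rw [if_neg hi, if_pos hit, h4, add_zero, zero_add]
        congr 1
        simp only [matrixBC, Matrix.of_apply, h1, hi, if_false]
        rw [dif_pos (h2.2 hit), hg]
        have hval : (i : ℕ) = t := by rw [hit]
        have hji : j = i ↔ (j : ℕ) = t := by rw [Fin.ext_iff, hval]
        have hlt : (⟨i, by omega⟩ : Fin (t + 1)) = Fin.last t := Fin.ext hval
        simp only [hji, hlt]
        split_ifs <;> first | omega | simp
      · rw [if_neg hi, if_neg hit, zero_add, zero_add]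
        simp only [matrixBC, Matrix.of_apply, h1, hi, if_false]
        rw [dif_neg (fun h => hit (h2.1 h))]
        by_cases hj : j = i
        · subst hj
          have : ¬ (j = Fin.last n ∨ (j : ℕ) = t) := by
            rintro (h | h)
            · exact hi h
            · exact hit (Fin.ext h)
          simp [this]
        · simp [hj, Ne.symm hj]
  rw [Finset.sum_congr rfl fun i _ => h i, Finset.sum_add_distrib, Finset.sum_add_distrib,
    Finset.sum_ite_eq', Finset.sum_ite_eq', Finset.sum_ite_eq']
  simp

theorem exists_perm_mem_iff {α : Type*} [Finite α] {S T : Set α} (h : S.ncard = T.ncard) :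
    ∃ σ : Equiv.Perm α, ∀ i, σ i ∈ T ↔ i ∈ S := by
  classical
  have := Fintype.ofFinite α
  have : Nat.card {x // x ∈ S} = Nat.card {x // x ∈ T} := h
  have e : {x // x ∈ S} ≃ {x // x ∈ T} :=
    Fintype.equivOfCardEq (by rwa [← Nat.card_eq_fintype_card, ← Nat.card_eq_fintype_card])
  refine ⟨e.extendSubtype, fun i => ?_⟩
  constructor
  · intro hi
    by_contra hn
    exact e.extendSubtype_not_mem i hn hi
  · exact e.extendSubtype_mem i

/-- Here t = s - 1. As C equals q on the columns up to t, the last row vanishes there, so the two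
nontrivial rows have disjoint supports and the system splits into two blocks. -/
theorem sum_mul_matrixBC_of_values {n t : ℕ} (ht : t < n) {q : ℤ} {B : Fin (t + 1) → ℤ}
    {C : Fin (n + 1) → ℤ} (hBlast : B (Fin.last t) = q) (hB : ∀ j, j ≠ Fin.last t → B j = 1)
    (hClast : C (Fin.last n) = q) (hC : ∀ j : Fin (n + 1), (j : ℕ) ≤ t → C j = q)
    (hC' : ∀ j : Fin (n + 1), t < (j : ℕ) → j ≠ Fin.last n → C j = 1)
    (c : Fin (n + 1) → ℝ) (j : Fin (n + 1)) :
    ∑ i, c i * matrixBC B C i j = if j = Fin.last n then c (Fin.last n) * q else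
      if (j : ℕ) = t then c j * q else
        c j + (q - 1) * (if (j : ℕ) ≤ t then c ⟨t, by omega⟩ else c (Fin.last n)) := by
  rw [sum_mul_matrixBC ht, hBlast, hClast]
  by_cases hj : j = Fin.last n
  · have h1 : ¬ n < t := by omega
    have h2 : n ≠ t := by omega
    subst hj
    simp [h1, h2]
  · by_cases hjt : (j : ℕ) = t
    · have h1 : (⟨t, by omega⟩ : Fin (n + 1)) = j := Fin.ext hjt.symm
      simp only [h1, hj, hjt, hC j hjt.le, if_false, if_true, lt_irrefl, dif_neg, or_true,
        not_false_eq_true]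
      ring
    · by_cases hlt : (j : ℕ) < t
      · have h1 : B ⟨j, by omega⟩ = 1 := hB _ fun h => hjt (by simpa [Fin.ext_iff] using h)
        simp only [hj, hjt, hlt, hlt.le, hC j hlt.le, h1, if_false, if_true, dif_pos, or_self]
        push_cast
        ring
      · have h1 : C j = 1 := hC' j (by omega) hj
        have h2 : ¬ (j : ℕ) ≤ t := by omega
        simp only [hj, hjt, hlt, h2, h1, if_false, dif_neg, or_self, not_false_eq_true]
        push_cast
        ring

theorem matrixBC_affineIndependent {n t : ℕ} (ht : t < n) {q : ℤ} (hq : q ≠ 0)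
    {B : Fin (t + 1) → ℤ}
    {C : Fin (n + 1) → ℤ} (hBlast : B (Fin.last t) = q) (hB : ∀ j, j ≠ Fin.last t → B j = 1)
    (hClast : C (Fin.last n) = q) (hC : ∀ j : Fin (n + 1), (j : ℕ) ≤ t → C j = q)
    (hC' : ∀ j : Fin (n + 1), t < (j : ℕ) → j ≠ Fin.last n → C j = 1) :
    AffineIndependent ℝ fun i => toReal (rowVertices (matrixBC B C) i) := by
  have hq' : (q : ℝ) ≠ 0 := by exact_mod_cast hq
  refine rowVertices_affineIndependent fun c hc => ?_
  simp only [sum_mul_matrixBC_of_values ht hBlast hB hClast hC hC'] at hc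
  have h1 : c (Fin.last n) = 0 := by
    have := hc (Fin.last n)
    rw [if_pos rfl] at this
    exact (mul_eq_zero.1 this).resolve_right hq'
  have h2 : c ⟨t, by omega⟩ = 0 := by
    have := hc ⟨t, by omega⟩
    rw [if_neg (by rw [Fin.ext_iff, Fin.val_last]; dsimp only; omega), if_pos rfl] at this
    exact (mul_eq_zero.1 this).resolve_right hq'
  intro i
  by_cases hi : i = Fin.last n
  · rw [hi, h1]
  · by_cases hit : (i : ℕ) = t
    · rw [← h2]
      congr 1
      exact Fin.ext hit
    · have := hc i
      rwa [if_neg hi, if_neg hit, h1, h2, ite_self, mul_zero, add_zero] at this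

/-- Rows t and `Fin.last n` supply the free residues a/q and b/q, one for each block. The set T is
prescribed only away from the origin vertex; the two divisibility hypotheses take care of that one.
-/
theorem mem_relLattice_matrixBC {n t : ℕ} (ht : t < n) {q : ℤ} (hq : q ≠ 0)
    {B : Fin (t + 1) → ℤ}
    {C : Fin (n + 1) → ℤ} (hBlast : B (Fin.last t) = q) (hB : ∀ j, j ≠ Fin.last t → B j = 1)
    (hClast : C (Fin.last n) = q) (hC : ∀ j : Fin (n + 1), (j : ℕ) ≤ t → C j = q)
    (hC' : ∀ j : Fin (n + 1), t < (j : ℕ) → j ≠ Fin.last n → C j = 1)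
    {T : Set (Fin (n + 2))} (hT : ∀ j : Fin (n + 1), j.succ ∈ T ↔ (j : ℕ) ≤ t)
    (hcardT : q ∣ (T.ncard : ℤ)) (hcard : q ∣ (n + 2 : ℤ)) (c : Fin (n + 2) → ℝ) :
    c ∈ relLattice (rowVertices (matrixBC B C)) ↔
      ∃ a b : ℤ, (∀ i ∈ T, ∃ z : ℤ, c i = a / q + z) ∧ ∀ i ∉ T, ∃ z : ℤ, c i = b / q + z := by
  classical
  have hq' : (q : ℝ) ≠ 0 := by exact_mod_cast hq
  let u : ℤ → ℤ → Fin (n + 2) → ℝ := fun a b i => if i ∈ T then (a / q : ℝ) else b / q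
  have hform : ∀ a b : ℤ, ((∀ i ∈ T, ∃ z : ℤ, c i = a / q + z) ∧
      ∀ i ∉ T, ∃ z : ℤ, c i = b / q + z) ↔ ∀ i, c i - u a b i ∈ integerSubgroup := by
    intro a b
    simp only [← sub_mem_integerSubgroup, u]
    constructor
    · rintro ⟨h1, h2⟩ i
      split_ifs with hi
      · exact h1 i hi
      · exact h2 i hi
    · intro h
      refine ⟨fun i hi => ?_, fun i hi => ?_⟩
      · simpa only [hi, if_true] using h i
      · simpa only [hi, if_false] using h i
  simp only [hform]
  have hu : ∀ a b : ℤ, ∑ i, u a b i ∈ integerSubgroup := by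
    intro a b
    obtain ⟨e, he⟩ := hcardT
    obtain ⟨f, hf⟩ := hcard
    -- Written this way, the sum depends only on |T| and on the number n + 2 of vertices.
    have h1 : ∀ i, u a b i = (if i ∈ T.toFinset then ((a - b) / q : ℝ) else 0) + b / q := by
      intro i
      simp only [u, Set.mem_toFinset]
      split_ifs <;> ring
    have h2 : (T.toFinset.card : ℝ) = q * e := by
      rw [← Set.ncard_eq_toFinset_card']
      exact_mod_cast he
    have h3 : ((n : ℝ) + 2) = q * f := by exact_mod_cast hf
    rw [Finset.sum_congr rfl fun i _ => h1 i, Finset.sum_add_distrib, Finset.sum_ite_mem,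
      Finset.univ_inter, Finset.sum_const, Finset.sum_const, Finset.card_univ, Fintype.card_fin,
      nsmul_eq_mul, nsmul_eq_mul, h2, mem_integerSubgroup]
    refine ⟨e * (a - b) + f * b, ?_⟩
    push_cast
    rw [h3]
    field_simp
  simp only [mem_relLattice_iff_integerSubgroup, sum_smul_rowVertices,
    sum_mul_matrixBC_of_values ht hBlast hB hClast hC hC' fun i => c i.succ]
  have hlast : (Fin.last n).succ ∉ T := by rw [hT, Fin.val_last]; omega
  have htn : (⟨t, by omega⟩ : Fin (n + 1)) ≠ Fin.last n := by
    rw [Ne, Fin.ext_iff, Fin.val_last]; dsimp only; omega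
  have htT : (⟨t, by omega⟩ : Fin (n + 1)).succ ∈ T := by rw [hT]
  constructor
  · rintro ⟨hs, hc⟩
    have h1 := hc (Fin.last n)
    rw [if_pos rfl, mem_integerSubgroup] at h1
    obtain ⟨b, hb⟩ := h1
    have h2 := hc ⟨t, by omega⟩
    rw [if_neg htn, if_pos rfl, mem_integerSubgroup] at h2
    obtain ⟨a, ha⟩ := h2
    rw [← eq_div_iff hq'] at ha hb
    have hsucc : ∀ i : Fin (n + 1), c i.succ - u a b i.succ ∈ integerSubgroup := by
      intro i
      have h3 := hc i
      by_cases hi : i = Fin.last n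
      · subst hi
        simp only [u, if_neg hlast, hb, sub_self, integerSubgroup.zero_mem]
      · rw [if_neg hi] at h3
        by_cases hit : (i : ℕ) = t
        · have : i = ⟨t, by omega⟩ := Fin.ext hit
          rw [this]
          simp only [u, if_pos htT, ha, sub_self, integerSubgroup.zero_mem]
        · rw [if_neg hit] at h3
          by_cases hle : (i : ℕ) ≤ t
          · rw [if_pos hle, ha] at h3
            have h4 := integerSubgroup.sub_mem h3 (intCast_mem_integerSubgroup a)
            simp only [u, if_pos ((hT i).2 hle)]
            convert h4 using 1
            field_simp
            ring
          · rw [if_neg hle, hb] at h3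
            have h4 := integerSubgroup.sub_mem h3 (intCast_mem_integerSubgroup b)
            simp only [u, if_neg (mt (hT i).1 hle)]
            convert h4 using 1
            field_simp
            ring
    exact ⟨a, b, fun i => Fin.cases
      (zero_coordinate_mem_integerSubgroup hs (hu a b) hsucc) hsucc i⟩
  · rintro ⟨a, b, h⟩
    refine ⟨sum_mem_integerSubgroup_congr (hu a b) h, fun j => ?_⟩
    have h1 := h (Fin.last n).succ
    simp only [u, if_neg hlast] at h1
    have h2 := h (⟨t, by omega⟩ : Fin (n + 1)).succ
    simp only [u, if_pos htT] at h2
    have hmul : ∀ (e : ℤ) (x : ℝ), x - e / q ∈ integerSubgroup → x * q ∈ integerSubgroup := by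
      intro e x hx
      have h3 := integerSubgroup.add_mem (intCast_mul_mem_integerSubgroup q hx)
        (intCast_mem_integerSubgroup e)
      convert h3 using 1
      field_simp
      ring
    have hadd : ∀ (e : ℤ) (x y : ℝ), x - e / q ∈ integerSubgroup → y - e / q ∈ integerSubgroup →
        x + (q - 1) * y ∈ integerSubgroup := by
      intro e x y hx hy
      have h3 := integerSubgroup.add_mem (integerSubgroup.add_mem hx
        (intCast_mul_mem_integerSubgroup (q - 1) hy)) (intCast_mem_integerSubgroup e)
      convert h3 using 1
      push_cast
      field_simp
      ring
    by_cases hj : j = Fin.last n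
    · rw [if_pos hj]
      exact hmul b _ h1
    · rw [if_neg hj]
      have h3 := h j.succ
      by_cases hle : (j : ℕ) ≤ t
      · simp only [u, if_pos ((hT j).2 hle)] at h3
        split_ifs
        · exact hmul a _ h3
        · exact hadd a _ _ h3 h2
      · simp only [u, if_neg (mt (hT j).1 hle)] at h3
        rw [if_neg (by omega), if_neg hle]
        exact hadd b _ _ h3 h1

/-! ### From the δ-polynomial to the three families. -/

theorem coeff_sum_X_pow {α : Type*} (s : Finset α) (f : α → ℕ) (n : ℕ) :
    PowerSeries.coeff n (∑ x ∈ s, (PowerSeries.X : PowerSeries ℤ) ^ f x) =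
      ((s.filter fun x => f x = n).card : ℤ) := by
  rw [map_sum, Finset.card_filter]
  push_cast
  refine Finset.sum_congr rfl fun x _ => ?_
  rw [PowerSeries.coeff_X_pow]
  simp only [eq_comm]

/-- If `δ(Δ, t) = 1 + t^m + ⋯ + t^((N - 1) m)`, then the half-open fundamental box has exactly one
point of each height `0, m, …, (N - 1) m`. -/
theorem unitBox_heights {d : ℕ} {v : Fin (d + 1) → Fin d → ℤ}
    (hv : AffineIndependent ℝ fun i => toReal (v i)) {N m : ℕ} (hm : 0 < m)
    (hδ : deltaSeries (convexHull ℝ (Set.range fun i => toReal (v i))) =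
      ∑ i ∈ Finset.range N, (PowerSeries.X : PowerSeries ℤ) ^ (i * m)) :
    (∀ c ∈ unitBox (relLattice v), ∃ j < N, ∑ i, c i = (j : ℝ) * m) ∧
    (∀ j < N, ∃ c ∈ unitBox (relLattice v), ∑ i, c i = (j : ℝ) * m) ∧
    ∀ c ∈ unitBox (relLattice v), ∀ c' ∈ unitBox (relLattice v),
      ∑ i, c i = ∑ i, c' i → c = c' := by
  rw [deltaSeries_convexHull hv] at hδ
  have hcard : ∀ n, ((unitBox_finite hv).toFinset.filter fun x => ⌊∑ i, x i⌋₊ = n).card =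
      ((Finset.range N).filter fun i => i * m = n).card := by
    intro n
    have h1 := congrArg (PowerSeries.coeff n) hδ
    rw [coeff_sum_X_pow, coeff_sum_X_pow _ fun i => i * m] at h1
    exact_mod_cast h1
  -- The exponents i·m are distinct because m > 0, so every coefficient is 0 or 1.
  have hle : ∀ n, ((Finset.range N).filter fun i => i * m = n).card ≤ 1 := by
    intro n
    rw [Finset.card_le_one]
    simp only [Finset.mem_filter]
    rintro a ⟨_, ha⟩ b ⟨_, hb⟩
    exact Nat.eq_of_mul_eq_mul_right hm (ha.trans hb.symm)
  refine ⟨fun c hc => ?_, fun j hj => ?_, fun c hc c' hc' h => ?_⟩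
  · have h1 : 0 < ((unitBox_finite hv).toFinset.filter
        fun x => ⌊∑ i, x i⌋₊ = ⌊∑ i, c i⌋₊).card :=
      Finset.card_pos.2 ⟨c, by simp [hc]⟩
    rw [hcard] at h1
    obtain ⟨j, hj⟩ := Finset.card_pos.1 h1
    simp only [Finset.mem_filter, Finset.mem_range] at hj
    refine ⟨j, hj.1, ?_⟩
    rw [← cast_floor_sum_of_mem_unitBox hc, ← hj.2, Nat.cast_mul]
  · have h1 : 0 < ((Finset.range N).filter fun i => i * m = j * m).card :=
      Finset.card_pos.2 ⟨j, by simp [hj]⟩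
    rw [← hcard] at h1
    obtain ⟨c, hc⟩ := Finset.card_pos.1 h1
    simp only [Finset.mem_filter, Set.Finite.mem_toFinset] at hc
    refine ⟨c, hc.1, ?_⟩
    rw [← cast_floor_sum_of_mem_unitBox hc.1, hc.2, Nat.cast_mul]
  · have h1 := hle ⌊∑ i, c i⌋₊
    rw [← hcard, Finset.card_le_one] at h1
    exact h1 c (by simp [hc]) c' (by simp [hc', h])

theorem ofFn_eq_listA₁ {p k n : ℕ} (hn : n = p ^ 2 * (k + 1) - 2) :
    List.ofFn (fun i : Fin (n + 1) => if i = Fin.last n then (p : ℤ) ^ 2 else 1) =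
      listA₁ p k := by
  subst hn
  rw [listA₁]
  refine List.ext_getElem (by simp) fun i h1 h2 => ?_
  simp only [List.length_ofFn] at h1
  simp only [List.getElem_ofFn, List.getElem_append, List.length_replicate, List.getElem_replicate,
    List.getElem_singleton, Fin.ext_iff, Fin.val_last]
  split_ifs <;> first | rfl | omega

theorem ofFn_eq_listA₂ {p k n : ℕ}
    (hn : n = (p * (k + 1) - 1) + ((p ^ 2 - 1) * (k + 1) - 1)) :
    List.ofFn (fun i : Fin (n + 1) => if i = Fin.last n then (p : ℤ) ^ 2 else
      if (i : ℕ) < p * (k + 1) - 1 then 1 else (p : ℤ)) = listA₂ p k := by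
  rw [listA₂]
  generalize p * (k + 1) - 1 = a at *
  generalize (p ^ 2 - 1) * (k + 1) - 1 = b at *
  subst hn
  refine List.ext_getElem (by simp; ring) fun i h1 h2 => ?_
  simp only [List.length_ofFn] at h1
  simp only [List.getElem_ofFn, List.getElem_append, List.length_replicate, List.getElem_replicate,
    List.getElem_singleton, Fin.ext_iff, Fin.val_last, List.length_append]
  split_ifs <;> first | rfl | omega

theorem ofFn_eq_listB {p k t : ℕ} (ht : t = p * (k + 1) - 1) :
    List.ofFn (fun i : Fin (t + 1) => if i = Fin.last t then (p : ℤ) else 1) = listB p k := by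
  subst ht
  rw [listB]
  refine List.ext_getElem (by simp) fun i h1 h2 => ?_
  simp only [List.length_ofFn] at h1
  simp only [List.getElem_ofFn, List.getElem_append, List.length_replicate, List.getElem_replicate,
    List.getElem_singleton, Fin.ext_iff, Fin.val_last]
  split_ifs <;> first | rfl | omega

theorem ofFn_eq_listC {p k n : ℕ} (hn : n = p * (k + 1) + (p ^ 2 * (k + 1) - 2)) :
    List.ofFn (fun i : Fin (n + 1) => if i = Fin.last n then (p : ℤ) else
      if (i : ℕ) < p * (k + 1) then (p : ℤ) else 1) = listC p k := by
  rw [listC]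
  generalize p * (k + 1) = a at *
  generalize p ^ 2 * (k + 1) - 2 = b at *
  subst hn
  refine List.ext_getElem (by simp; ring) fun i h1 h2 => ?_
  simp only [List.length_ofFn] at h1
  simp only [List.getElem_ofFn, List.getElem_append, List.length_replicate, List.getElem_replicate,
    List.getElem_singleton, Fin.ext_iff, Fin.val_last, List.length_append]
  split_ifs <;> first | rfl | omega

theorem classification_of_nonpyramid {p k n : ℕ} (hp : p.Prime) {v : Fin (n + 2) → Fin (n + 1) → ℤ}
    (hv : AffineIndependent ℝ fun i => toReal (v i))
    (hδ : deltaSeries (convexHull ℝ (Set.range fun i => toReal (v i))) =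
      ∑ i ∈ Finset.range (p ^ 2), (PowerSeries.X : PowerSeries ℤ) ^ (i * (k + 1)))
    (hpyr : ¬ IsLatticePyramid (convexHull ℝ (Set.range fun i => toReal (v i)))) :
    (∃ A : Fin (n + 1) → ℤ, List.ofFn A = listA₁ p k ∧
      UnimodularlyEquivalent (convexHull ℝ (Set.range fun i => toReal (v i))) (simplexA A)) ∨
    (∃ A : Fin (n + 1) → ℤ, List.ofFn A = listA₂ p k ∧
      UnimodularlyEquivalent (convexHull ℝ (Set.range fun i => toReal (v i))) (simplexA A)) ∨
    (∃ (s : ℕ) (B : Fin s → ℤ) (C : Fin (n + 1) → ℤ),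
      List.ofFn B = listB p k ∧ List.ofFn C = listC p k ∧
      UnimodularlyEquivalent (convexHull ℝ (Set.range fun i => toReal (v i)))
        (simplexBC B C)) := by
  have hm : 0 < k + 1 := k.succ_pos
  obtain ⟨hht, hsurj, hinj⟩ := unitBox_heights hv hm hδ
  have hp0 : (p : ℤ) ≠ 0 := by exact_mod_cast hp.ne_zero
  have hfull : ∀ i, ∃ c ∈ relLattice v, ∀ z : ℤ, c i ≠ z := by
    intro i
    by_contra hcon
    push Not at hcon
    exact hpyr (isLatticePyramid_of_integral_coordinate hv i hcon)
  have hpm : 2 ≤ p * (k + 1) := by nlinarith [hp.two_le]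
  have hp2 : 4 ≤ p ^ 2 := by nlinarith [hp.two_le]
  have hp2m : 4 ≤ p ^ 2 * (k + 1) := by nlinarith
  have hp2m' : (p ^ 2 - 1) * (k + 1) + (k + 1) = p ^ 2 * (k + 1) := by
    rw [← Nat.succ_mul, Nat.succ_eq_add_one, Nat.sub_add_cancel (by omega)]
  have hp2m1 : 3 ≤ (p ^ 2 - 1) * (k + 1) := by
    calc 3 = 3 * 1 := rfl
      _ ≤ (p ^ 2 - 1) * (k + 1) := Nat.mul_le_mul (by omega) (by omega)
  rcases lattice_classification (intCast_mem_relLattice v) hp hm hht hsurj hinj hfull with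
    ⟨hcard, hL⟩ | ⟨S, hS, hcard, hL⟩ | ⟨S, hS, hcard, hL⟩
  · left
    rw [Fintype.card_fin] at hcard
    refine ⟨_, ofFn_eq_listA₁ (n := n) (by omega), ?_⟩
    rw [simplexA, rowSimplex_eq_convexHull_rowVertices]
    set A : Fin (n + 1) → ℤ := fun i => if i = Fin.last n then (p : ℤ) ^ 2 else 1 with hA
    have hAlast : A (Fin.last n) = (p : ℤ) ^ 2 := if_pos rfl
    have hA0 : A (Fin.last n) ≠ 0 := by rw [hAlast]; exact pow_ne_zero _ hp0
    refine unimodularlyEquivalent_of_relLattice_eq hv (matrixA_affineIndependent hA0) ?_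
    ext c
    rw [hL, mem_relLattice_matrixA (α := fun _ => 1) hA0 rfl (fun j hj => (if_neg hj).symm)]
    · simp only [hAlast, Int.cast_one, mul_one, Int.cast_pow, Int.cast_natCast]
    · rw [hAlast]
      refine ⟨k + 1, ?_⟩
      simp only [Finset.sum_const, Finset.card_univ, Fintype.card_fin, nsmul_eq_mul, mul_one]
      exact_mod_cast hcard
  · right; left
    rw [Fintype.card_fin] at hcard
    refine ⟨_, ofFn_eq_listA₂ (n := n) (by omega), ?_⟩
    rw [simplexA, rowSimplex_eq_convexHull_rowVertices]
    set A : Fin (n + 1) → ℤ := fun i => if i = Fin.last n then (p : ℤ) ^ 2 else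
      if (i : ℕ) < p * (k + 1) - 1 then 1 else (p : ℤ) with hA
    have hAlast : A (Fin.last n) = (p : ℤ) ^ 2 := if_pos rfl
    have hA0 : A (Fin.last n) ≠ 0 := by rw [hAlast]; exact pow_ne_zero _ hp0
    classical
    -- The vertices of weight 1: those of the p(k+1) - 1 entries 1 of A₂ and the last one. The rest,
    -- including the origin, have weight p, and p/p² = 1/p.
    let T : Finset (Fin (n + 2)) := (insert (Fin.last n)
      (Finset.univ.filter fun j : Fin (n + 1) => (j : ℕ) < p * (k + 1) - 1)).map
        (Fin.succEmb (n + 1))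
    have hTcard : T.card = p * (k + 1) := by
      rw [Finset.card_map, Finset.card_insert_of_notMem, Fin.card_filter_val_lt]
      · omega
      · simp only [Finset.mem_filter, Finset.mem_univ, true_and, Fin.val_last]
        omega
    have hT : ∀ j : Fin (n + 1), j.succ ∈ T ↔ j = Fin.last n ∨ (j : ℕ) < p * (k + 1) - 1 := by
      intro j
      simp [T]
    obtain ⟨σ, hσ⟩ := exists_perm_mem_iff (S := S) (T := (T : Set (Fin (n + 2))))
      (by rw [hS, Set.ncard_coe_finset, hTcard])
    simp only [Finset.mem_coe] at hσ
    refine unimodularlyEquivalent_of_relLattice_perm hv (matrixA_affineIndependent hA0) σ ?_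
    intro c
    rw [hL, mem_relLattice_matrixA (α := fun i => if i ∈ T then 1 else (p : ℤ)) hA0
      (if_pos ((hT _).2 (Or.inl rfl)))]
    · refine exists_congr fun a => ?_
      rw [hAlast, ← σ.forall_congr_right (q := fun i => ∃ z : ℤ, (c ∘ σ.symm) i = _ + (z : ℝ))]
      have hpr : (p : ℝ) ≠ 0 := by exact_mod_cast hp.ne_zero
      have hdiv : (a * p / p ^ 2 : ℝ) = a / p := by field_simp
      constructor
      · rintro ⟨h1, h2⟩ i
        simp only [Function.comp_apply, Equiv.symm_apply_apply]
        by_cases hi : i ∈ S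
        · rw [if_pos ((hσ i).2 hi)]
          simpa using h1 i hi
        · rw [if_neg (mt (hσ i).1 hi)]
          simpa [hdiv] using h2 i hi
      · intro h
        refine ⟨fun i hi => ?_, fun i hi => ?_⟩
        · have h1 := h i
          rw [if_pos ((hσ i).2 hi)] at h1
          simpa using h1
        · have h1 := h i
          rw [if_neg (mt (hσ i).1 hi)] at h1
          simpa [hdiv] using h1
    · intro j hj
      simp only [hT, hj, false_or, hA, if_false]
    · rw [hAlast]
      -- With m = k+1 the weights sum to pm + p(p²-1)m = p²·pm.
      refine ⟨p * (k + 1), ?_⟩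
      have h1 : ∀ i : Fin (n + 2), (if i ∈ T then 1 else (p : ℤ)) =
          (if i ∈ T then 1 - (p : ℤ) else 0) + p := by
        intro i
        split_ifs <;> ring
      rw [Finset.sum_congr rfl fun i _ => h1 i, Finset.sum_add_distrib, Finset.sum_ite_mem,
        Finset.univ_inter, Finset.sum_const, Finset.sum_const, Finset.card_univ, Fintype.card_fin,
        hTcard, nsmul_eq_mul, nsmul_eq_mul]
      have h2 : ((n + 1 + 1 : ℕ) : ℤ) = p * (k + 1) + p ^ 2 * (k + 1) - (k + 1) := by
        have h3 : n + 1 + 1 + (k + 1) = p * (k + 1) + p ^ 2 * (k + 1) := by omega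
        have h4 : ((n + 1 + 1 : ℕ) : ℤ) + (k + 1) = p * (k + 1) + p ^ 2 * (k + 1) := by
          exact_mod_cast h3
        linarith
      rw [h2]
      push_cast
      ring
  · right; right
    rw [Fintype.card_fin] at hcard
    obtain ⟨t, ht⟩ : ∃ t, t + 1 = p * (k + 1) := ⟨p * (k + 1) - 1, by omega⟩
    refine ⟨t + 1, _, _, ofFn_eq_listB (t := t) (by omega), ofFn_eq_listC (n := n) (by omega), ?_⟩
    rw [simplexBC, rowSimplex_eq_convexHull_rowVertices]
    have htn : t < n := by omega
    set B : Fin (t + 1) → ℤ := fun i => if i = Fin.last t then (p : ℤ) else 1 with hB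
    set C : Fin (n + 1) → ℤ := fun i => if i = Fin.last n then (p : ℤ) else
      if (i : ℕ) < p * (k + 1) then (p : ℤ) else 1 with hC
    have h1 : B (Fin.last t) = p := if_pos rfl
    have h2 : ∀ j, j ≠ Fin.last t → B j = 1 := fun j hj => if_neg hj
    have h3 : C (Fin.last n) = p := if_pos rfl
    have h4 : ∀ j : Fin (n + 1), (j : ℕ) ≤ t → C j = p := by
      intro j hj
      simp only [hC, ← ht, Nat.lt_succ_of_le hj, if_true, ite_self]
    have h5 : ∀ j : Fin (n + 1), t < (j : ℕ) → j ≠ Fin.last n → C j = 1 := by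
      intro j hj hjn
      have : ¬ (j : ℕ) < t + 1 := by omega
      simp only [hC, ← ht, hjn, this, if_false]
    classical
    -- The vertices of the first s = t + 1 rows; the origin is put in the other class, which has
    -- p²(k+1) elements.
    let T : Finset (Fin (n + 2)) :=
      (Finset.univ.filter fun j : Fin (n + 1) => (j : ℕ) < t + 1).map (Fin.succEmb (n + 1))
    have hTcard : T.card = p * (k + 1) := by
      rw [Finset.card_map, Fin.card_filter_val_lt]
      omega
    have hT : ∀ j : Fin (n + 1), j.succ ∈ (T : Set (Fin (n + 2))) ↔ (j : ℕ) ≤ t := by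
      intro j
      simp [T]
    obtain ⟨σ, hσ⟩ := exists_perm_mem_iff (S := S) (T := (T : Set (Fin (n + 2))))
      (by rw [hS, Set.ncard_coe_finset, hTcard])
    refine unimodularlyEquivalent_of_relLattice_perm hv
      (matrixBC_affineIndependent htn hp0 h1 h2 h3 h4 h5) σ fun c => ?_
    rw [hL, mem_relLattice_matrixBC htn hp0 h1 h2 h3 h4 h5 hT]
    · refine exists₂_congr fun a b => and_congr ?_ ?_
      · rw [← σ.forall_congr_right (q := fun i => i ∈ (T : Set (Fin (n + 2))) → _)]
        simp only [hσ, Function.comp_apply, Equiv.symm_apply_apply, Int.cast_natCast]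
      · rw [← σ.forall_congr_right (q := fun i => i ∉ (T : Set (Fin (n + 2))) → _)]
        simp only [hσ, Function.comp_apply, Equiv.symm_apply_apply, Int.cast_natCast]
    · rw [Set.ncard_coe_finset, hTcard]
      exact ⟨k + 1, by push_cast; ring⟩
    · refine ⟨(k + 1) + p * (k + 1), ?_⟩
      have h6 : ((n + 2 : ℕ) : ℤ) = ((p * (k + 1) + p ^ 2 * (k + 1) : ℕ) : ℤ) :=
        congrArg _ hcard
      push_cast at h6
      rw [h6]
      ring

end LatticeSimplices

end

theorem corollary3p6 (p k d : ℕ) (hp : p.Prime) (Δ : Set (Fin d → ℝ))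
    (hΔ : LatticeSimplices.IsLatticeSimplex Δ)
    (hδ : LatticeSimplices.deltaSeries Δ =
      ∑ i ∈ Finset.range (p ^ 2), (PowerSeries.X : PowerSeries ℤ) ^ (i * (k + 1)))
    (hpyr : ¬ LatticeSimplices.IsLatticePyramid Δ) :
    (∃ A : Fin d → ℤ, List.ofFn A = LatticeSimplices.listA₁ p k ∧
      LatticeSimplices.UnimodularlyEquivalent Δ (LatticeSimplices.simplexA A)) ∨
    (∃ A : Fin d → ℤ, List.ofFn A = LatticeSimplices.listA₂ p k ∧
      LatticeSimplices.UnimodularlyEquivalent Δ (LatticeSimplices.simplexA A)) ∨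
    (∃ (s : ℕ) (B : Fin s → ℤ) (C : Fin d → ℤ),
      List.ofFn B = LatticeSimplices.listB p k ∧ List.ofFn C = LatticeSimplices.listC p k ∧
      LatticeSimplices.UnimodularlyEquivalent Δ (LatticeSimplices.simplexBC B C)) := by
  obtain ⟨v, hv, rfl⟩ := hΔ
  rcases d with _ | n
  -- In dimension 0 the only coefficient is below 1, so the height k + 1 ≥ 1 cannot be attained.
  · exfalso
    obtain ⟨c, ⟨_, hc⟩, hsum⟩ := (LatticeSimplices.unitBox_heights hv k.succ_pos hδ).2.1 1
      (by nlinarith [hp.two_le])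
    rw [Fin.sum_univ_one] at hsum
    have h1 := (hc 0).2
    rw [hsum] at h1
    push_cast at h1
    linarith [k.cast_nonneg (α := ℝ)]
  · exact LatticeSimplices.classification_of_nonpyramid hp hv hδ hpyr
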